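/- Let $\mathbb{K}$ be a field of characteristic zero and let $\mathcal{R}_0$ be the unital associative $\mathbb{K}$-algebra freely generated by symbols $u_{n+1}^{(j)}$ ($n\ge 1$, $j\ge 0$), with the derivation $\partial_x$ given by $\partial_x u_{n+1}^{(j)}=u_{n+1}^{(j+1)}$; write $u_{n+1}=u_{n+1}^{(0)}$. Consider the algebra of formal pseudo-differential operators $\sum_{i\le N}a_i\partial^i$ ($N\in\mathbb{Z}$, $a_i\in\mathcal{R}_0$) with the product determined by $\partial^i f=\sum_{k\ge 0}\binom{i}{k}(\partial_x^k f)\,\partial^{i-k}$, and let $X_{\ge 0}$, $X_{<0}$ be the parts of $X$ with non-negative, respectively negative, powers of $\partial$. Let $L=\partial+\sum_{n\ge 1}u_{n+1}\partial^{-n}$ and let $\mathcal{R}$ be the smallest $\mathbb{K}$-subalgebra that contains $L$ and $\partial^{-1}$ and is closed under $X\mapsto X_{\ge 0}$. Let $\mathcal{A}(P)$ be the $\mathbb{K}$-vector space generated freely from one element $P$ by two bilinear products $\prec,\bullet$ that satisfy $(\alpha\ast_1\beta)\ast_2\gamma=\alpha\ast_1(\beta\ast_2\gamma)$ for all $\ast_1,\ast_2\in\{\prec,\bullet\}$;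 put $\alpha\succ\beta=\alpha\prec\beta+\alpha\bullet\beta$, $P_n=P^{\bullet n}$ and $P_{m_1\ldots m_k}=P_{m_1}\prec\cdots\prec P_{m_k}$. Let $\ell:\mathcal{A}(P)\to\mathcal{R}$ be the linear map with $\ell(P)=L$, $\ell(\alpha\prec P)=-\ell(\alpha)_{<0}L$, $\ell(\alpha\succ P)=\ell(\alpha)_{\ge 0}L$, and put $L^{m_1,\ldots,m_k}=\ell(P_{m_1\ldots m_k})$ for positive integers $m_1,\ldots,m_k$. Then there is exactly one family of $\mathbb{K}$-linear operators $\delta_{m_1\ldots m_k}:\mathcal{R}\to\mathcal{R}$ ($k\ge 0$, $m_i\ge 1$), with $\delta=\mathrm{id}$ for $k=0$, such that for all $X,Y\in\mathcal{R}$ $$\delta_{m_1\ldots m_k}L=-[L^{m_1,\ldots,m_k}_{<0},L]+\sum_{j=1}^{k-1}(\delta_{m_1\ldots m_j}L)\,L^{m_{j+1},\ldots,m_k}_{<0}\quad(k\ge 1),$$ $$\delta_{m_1\ldots m_k}(X_{\ge 0})=(\delta_{m_1\ldots m_k}X)_{\ge 0},\qquad \delta_{m_1\ldots m_k}(XY)=\sum_{j=0}^{k}(\delta_{m_1\ldots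 m_j}X)(\delta_{m_{j+1}\ldots m_k}Y),$$ and these generalized derivations commute: $$[\delta_{m_1\ldots m_k},\delta_{n_1\ldots n_l}]=0 .$$ In particular the following flows are compatible, in the sense that the operators on $\mathcal{R}$ that define them commute when applied to $L$. (ncKP) Each $\delta_n$ is a derivation of $\mathcal{R}$, $\delta_nL=[(L^n)_{\ge 0},L]=-[(L^n)_{<0},L]$, and $\delta_m\delta_nL=\delta_n\delta_mL$. (xncKP) The operators $\vartheta_{mn}=\frac12(\delta_{mn}-\delta_{nm})$ satisfy $\vartheta_{mn}(XY)=(\vartheta_{mn}X)Y+X\,\vartheta_{mn}Y+\frac12\big((\delta_mX)(\delta_nY)-(\delta_nX)(\delta_mY)\big)$ and $\vartheta_{mn}L=[W^{(m,n)},L]+\frac12\big((\delta_nL)(L^m)_{\ge 0}-(\delta_mL)(L^n)_{\ge 0}\big)$ with $W^{(m,n)}=\frac12(L^{m,n}-L^{n,m})_{\ge 0}$; moreover $\vartheta_{mn}\vartheta_{pq}L=\vartheta_{pq}\vartheta_{mn}L$ and $\vartheta_{mn}\delta_pL=\delta_p\vartheta_{mn}L$. (XncKP) For $k\ge 1$,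 $\delta_{m_1\ldots m_k}L=[L^{m_1,\ldots,m_k}_{\ge 0},L]-\sum_{j=1}^{k-1}(\delta_{m_1\ldots m_j}L)\,L^{m_{j+1},\ldots,m_k}_{\ge 0}$, and $\delta_{m_1\ldots m_k}\delta_{n_1\ldots n_l}L=\delta_{n_1\ldots n_l}\delta_{m_1\ldots m_k}L$. -/

import Mathlib

/-! ### Derivations of noncommutative algebras -/

/-- A `K`-linear derivation of a (not necessarily commutative) `K`-algebra. -/
structure NCDeriv (K A : Type*) [Field K] [Ring A] [Algebra K A] where
  toLin : A →ₗ[K] A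
  leibniz : ∀ a b, toLin (a * b) = toLin a * b + a * toLin b

section PsiDO

variable {K A : Type*} [Field K] [Ring A] [Algebra K A]

namespace NCDeriv

variable (D : NCDeriv K A)

/-- The iterated derivation `D^k`. -/
def iter (k : ℕ) : A →ₗ[K] A := D.toLin ^ k

theorem iter_zero (a : A) : D.iter 0 a = a := by simp [iter]

theorem iter_iter (k l : ℕ) (a : A) : D.iter k (D.iter l a) = D.iter (k + l) a := by
  simp [iter, pow_add]

theorem toLin_one : D.toLin 1 = 0 := by
  have h := D.leibniz 1 1
  simpa using h

theorem iter_one (k : ℕ) (hk : k ≠ 0) : D.iter k (1 : A) = 0 := by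
  obtain ⟨k, rfl⟩ := Nat.exists_eq_succ_of_ne_zero hk
  simp [iter, pow_succ, toLin_one]

theorem iter_mul (k : ℕ) (a b : A) :
    D.iter k (a * b) =
      ∑ p ∈ Finset.HasAntidiagonal.antidiagonal k, k.choose p.1 • (D.iter p.1 a * D.iter p.2 b) := by
  induction k with
  | zero => simp [iter]
  | succ k ih =>
    have h1 : ∀ x : A, D.iter (k + 1) x = D.toLin (D.iter k x) := by
      intro x; simp [iter, pow_succ']
    have h2 : ∀ (i : ℕ) (x : A), D.toLin (D.iter i x) = D.iter (i + 1) x := by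
      intro i x; simp [iter, pow_succ']
    rw [h1, ih, map_sum, Finset.sum_antidiagonal_choose_succ_nsmul
      (fun i j => D.iter i a * D.iter j b)]
    simp only [map_nsmul, leibniz, h2, smul_add, Finset.sum_add_distrib]
    rw [add_comm]
    congr 1
    refine Finset.sum_congr rfl fun p hp => ?_
    rw [Nat.choose_symm_of_eq_add (Finset.HasAntidiagonal.mem_antidiagonal.mp hp).symm]

end NCDeriv

/-! ### Formal pseudo-differential operators -/

/-- The coefficient families `(a_i)`, `i ∈ ℤ`, with `a_i = 0` for all large `i`. -/
def psiSubmodule (K A : Type*) [Field K] [Ring A] [Algebra K A] : Submodule K (ℤ → A) where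
  carrier := {a | ∃ N : ℤ, ∀ i, N < i → a i = 0}
  zero_mem' := ⟨0, fun _ _ => rfl⟩
  add_mem' := by
    rintro a b ⟨N, hN⟩ ⟨M, hM⟩
    refine ⟨max N M, fun i hi => ?_⟩
    simp [hN i (lt_of_le_of_lt (le_max_left _ _) hi), hM i (lt_of_le_of_lt (le_max_right _ _) hi)]
  smul_mem' := by
    rintro c a ⟨N, hN⟩
    exact ⟨N, fun i hi => by simp [hN i hi]⟩

/-- Formal pseudo-differential operators `∑_{i ≤ N} a_i ∂^i` with coefficients (written on the
left) in the differential algebra `(A, D)`. -/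
def PsiDO (_D : NCDeriv K A) : Type _ := psiSubmodule K A

namespace PsiDO

variable {D : NCDeriv K A}

noncomputable instance : AddCommGroup (PsiDO D) := inferInstanceAs (AddCommGroup (psiSubmodule K A))

noncomputable instance : Module K (PsiDO D) := inferInstanceAs (Module K (psiSubmodule K A))

/-- The coefficient of `∂^i`. -/
def coeff (X : PsiDO D) (i : ℤ) : A := X.1 i

/-- The operator with prescribed coefficients. -/
def mk (a : ℤ → A) (h : ∃ N : ℤ, ∀ i, N < i → a i = 0) : PsiDO D := ⟨a, h⟩

@[simp] theorem coeff_mk (a : ℤ → A) (h) (i : ℤ) : (mk a h : PsiDO D).coeff i = a i := rfl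

theorem bdd (X : PsiDO D) : ∃ N : ℤ, ∀ i, N < i → X.coeff i = 0 := X.2

@[ext] theorem ext {X Y : PsiDO D} (h : ∀ i, X.coeff i = Y.coeff i) : X = Y :=
  Subtype.ext (funext h)

@[simp] theorem coeff_zero (i : ℤ) : (0 : PsiDO D).coeff i = 0 := rfl
@[simp] theorem coeff_add (X Y : PsiDO D) (i : ℤ) : (X + Y).coeff i = X.coeff i + Y.coeff i := rfl
@[simp] theorem coeff_neg (X : PsiDO D) (i : ℤ) : (-X).coeff i = -X.coeff i := rfl
@[simp] theorem coeff_sub (X Y : PsiDO D) (i : ℤ) : (X - Y).coeff i = X.coeff i - Y.coeff i := rfl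
@[simp] theorem coeff_smul (c : K) (X : PsiDO D) (i : ℤ) : (c • X).coeff i = c • X.coeff i := rfl

/-- The coefficient of `∂^n` in the product `(∑ a_i ∂^i) (∑ b_j ∂^j)`, where
`∂^i b = ∑_{k ≥ 0} (i choose k) (D^k b) ∂^{i-k}` for all integers `i`; only finitely many
terms of the sum are nonzero. -/
noncomputable def mulCoeff (X Y : PsiDO D) (n : ℤ) : A :=
  ∑ᶠ p : ℤ × ℕ, Ring.choose p.1 p.2 • (X.coeff p.1 * D.iter p.2 (Y.coeff (n - p.1 + p.2)))

theorem mulCoeff_eq (X Y : PsiDO D) {N M : ℤ} (hN : ∀ i, N < i → X.coeff i = 0)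
    (hM : ∀ i, M < i → Y.coeff i = 0) (s : ℕ) :
    mulCoeff X Y (N + M - s) =
      ∑ p ∈ Finset.HasAntidiagonal.antidiagonal s, ∑ q ∈ Finset.HasAntidiagonal.antidiagonal p.2,
        Ring.choose (N - p.1) q.2 •
          (X.coeff (N - p.1) * D.iter q.2 (Y.coeff (M - q.1))) := by
  classical
  rw [Finset.sum_sigma']
  let e : (Σ _ : ℕ × ℕ, ℕ × ℕ) → ℤ × ℕ := fun x => (N - x.1.1, x.2.2)
  unfold mulCoeff
  rw [finsum_eq_finsetSum_of_support_subset (s :=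
    ((Finset.HasAntidiagonal.antidiagonal s).sigma fun p => Finset.HasAntidiagonal.antidiagonal p.2).image e)]
  · rw [Finset.sum_image]
    · refine Finset.sum_congr rfl ?_
      rintro ⟨⟨a, t⟩, ⟨b, k⟩⟩ h
      simp only [Finset.mem_sigma, Finset.HasAntidiagonal.mem_antidiagonal] at h
      have : N + M - (s : ℤ) - (N - (a : ℤ)) + (k : ℤ) = M - b := by omega
      simp only [e, this]
    · rintro ⟨⟨a, t⟩, ⟨b, k⟩⟩ h ⟨⟨a', t'⟩, ⟨b', k'⟩⟩ h' he
      simp only [Finset.coe_sigma, Set.mem_sigma_iff, Finset.mem_coe,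
        Finset.HasAntidiagonal.mem_antidiagonal] at h h'
      simp only [e, Prod.mk.injEq] at he
      obtain ⟨he1, he2⟩ := he
      obtain rfl : a = a' := by omega
      obtain rfl : k = k' := he2
      obtain rfl : t = t' := by omega
      obtain rfl : b = b' := by omega
      rfl
  · rintro ⟨i, k⟩ h
    have h1 : i ≤ N := by
      by_contra hc
      exact h (by simp [hN i (by omega)])
    have h2 : N + M - s - i + k ≤ M := by
      by_contra hc
      exact h (by simp only [hM _ (not_le.mp hc)]; simp)
    simp only [Finset.coe_image, Set.mem_image, Finset.mem_coe, Finset.mem_sigma,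
      Finset.HasAntidiagonal.mem_antidiagonal, e, Prod.mk.injEq]
    refine ⟨⟨((N - i).toNat, s - (N - i).toNat), (s - (N - i).toNat - k, k)⟩, ⟨?_, ?_⟩, ?_, rfl⟩
    · dsimp only; omega
    · dsimp only; omega
    · dsimp only; omega

theorem mulCoeff_eq_zero (X Y : PsiDO D) {N M : ℤ} (hN : ∀ i, N < i → X.coeff i = 0)
    (hM : ∀ i, M < i → Y.coeff i = 0) (n : ℤ) (hn : N + M < n) : mulCoeff X Y n = 0 := by
  unfold mulCoeff
  rw [← finsum_zero (α := ℤ × ℕ)]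
  refine finsum_congr ?_
  rintro ⟨i, k⟩
  by_cases hi : N < i
  · simp [hN i hi]
  · dsimp only
    rw [hM _ (by omega)]
    simp

noncomputable instance : Mul (PsiDO D) :=
  ⟨fun X Y => mk (mulCoeff X Y) (by
    obtain ⟨N, hN⟩ := X.bdd
    obtain ⟨M, hM⟩ := Y.bdd
    exact ⟨N + M, fun n hn => mulCoeff_eq_zero X Y hN hM n hn⟩)⟩

theorem coeff_mul (X Y : PsiDO D) (n : ℤ) :
    (X * Y).coeff n =
      ∑ᶠ p : ℤ × ℕ, Ring.choose p.1 p.2 • (X.coeff p.1 * D.iter p.2 (Y.coeff (n - p.1 + p.2))) :=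
  rfl

theorem coeff_mul_eq (X Y : PsiDO D) {N M : ℤ} (hN : ∀ i, N < i → X.coeff i = 0)
    (hM : ∀ i, M < i → Y.coeff i = 0) (s : ℕ) :
    (X * Y).coeff (N + M - s) =
      ∑ p ∈ Finset.HasAntidiagonal.antidiagonal s, ∑ q ∈ Finset.HasAntidiagonal.antidiagonal p.2,
        Ring.choose (N - p.1) q.2 •
          (X.coeff (N - p.1) * D.iter q.2 (Y.coeff (M - q.1))) :=
  mulCoeff_eq X Y hN hM s

theorem coeff_mul_eq_zero (X Y : PsiDO D) {N M : ℤ} (hN : ∀ i, N < i → X.coeff i = 0)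
    (hM : ∀ i, M < i → Y.coeff i = 0) (n : ℤ) (hn : N + M < n) : (X * Y).coeff n = 0 :=
  mulCoeff_eq_zero X Y hN hM n hn

/-- The monomial `a ∂^i`. -/
def monomial (i : ℤ) (a : A) : PsiDO D :=
  mk (fun j => if j = i then a else 0) ⟨i, fun j hj => if_neg (by omega)⟩

@[simp] theorem coeff_monomial (i : ℤ) (a : A) (j : ℤ) :
    (monomial i a : PsiDO D).coeff j = if j = i then a else 0 := rfl

noncomputable instance : One (PsiDO D) := ⟨monomial 0 1⟩

theorem one_def : (1 : PsiDO D) = monomial 0 1 := rfl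

theorem exists_bdd₂ (X Y : PsiDO D) :
    ∃ N : ℤ, (∀ i, N < i → X.coeff i = 0) ∧ (∀ i, N < i → Y.coeff i = 0) := by
  obtain ⟨N, hN⟩ := X.bdd
  obtain ⟨M, hM⟩ := Y.bdd
  exact ⟨max N M, fun i hi => hN i (by omega), fun i hi => hM i (by omega)⟩

theorem coeff_mul_ext {X Y Z : PsiDO D} {N M : ℤ} (hN : ∀ i, N < i → X.coeff i = 0)
    (hM : ∀ i, M < i → Y.coeff i = 0) (hZ : ∀ i, N + M < i → Z.coeff i = 0)
    (h : ∀ s : ℕ, (X * Y).coeff (N + M - s) = Z.coeff (N + M - s)) : X * Y = Z := by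
  ext n
  by_cases hn : N + M < n
  · rw [coeff_mul_eq_zero X Y hN hM n hn, hZ n hn]
  · have := h (N + M - n).toNat
    rwa [show N + M - (((N + M - n).toNat : ℕ) : ℤ) = n by omega] at this

private theorem one_mul' (X : PsiDO D) : 1 * X = X := by
  obtain ⟨N, hN⟩ := X.bdd
  ext n
  rw [coeff_mul, finsum_eq_single _ ((0 : ℤ), 0)]
  · simp [one_def, NCDeriv.iter_zero]
  · rintro ⟨i, k⟩ h
    by_cases hi : i = 0
    · subst hi
      have hk : k ≠ 0 := by rintro rfl; exact h rfl
      simp [Ring.choose_zero_pos ℤ (Nat.pos_of_ne_zero hk)]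
    · simp [one_def, hi]

private theorem mul_one' (X : PsiDO D) : X * 1 = X := by
  ext n
  rw [coeff_mul, finsum_eq_single _ (n, 0)]
  · simp [one_def, NCDeriv.iter_zero]
  · rintro ⟨i, k⟩ h
    by_cases hk : k = 0
    · subst hk
      have hi : n - i ≠ 0 := by
        intro hc; exact h (by rw [show i = n by omega])
      simp [one_def, hi]
    · simp only [one_def, coeff_monomial]
      split_ifs <;> simp [D.iter_one k hk]

private theorem add_mul' (X Y Z : PsiDO D) : (X + Y) * Z = X * Z + Y * Z := by
  obtain ⟨N, hX, hY⟩ := exists_bdd₂ X Y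
  obtain ⟨M, hZ⟩ := Z.bdd
  have hXY : ∀ i, N < i → (X + Y).coeff i = 0 := fun i hi => by simp [hX i hi, hY i hi]
  refine coeff_mul_ext hXY hZ (fun i hi => ?_) fun s => ?_
  · simp [coeff_mul_eq_zero X Z hX hZ i hi, coeff_mul_eq_zero Y Z hY hZ i hi]
  · rw [coeff_add, coeff_mul_eq _ _ hXY hZ, coeff_mul_eq _ _ hX hZ, coeff_mul_eq _ _ hY hZ]
    simp only [coeff_add, add_mul, smul_add, Finset.sum_add_distrib]

private theorem mul_add' (X Y Z : PsiDO D) : X * (Y + Z) = X * Y + X * Z := by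
  obtain ⟨N, hX⟩ := X.bdd
  obtain ⟨M, hY, hZ⟩ := exists_bdd₂ Y Z
  have hYZ : ∀ i, M < i → (Y + Z).coeff i = 0 := fun i hi => by simp [hY i hi, hZ i hi]
  refine coeff_mul_ext hX hYZ (fun i hi => ?_) fun s => ?_
  · simp [coeff_mul_eq_zero X Y hX hY i hi, coeff_mul_eq_zero X Z hX hZ i hi]
  · rw [coeff_add, coeff_mul_eq _ _ hX hYZ, coeff_mul_eq _ _ hX hY, coeff_mul_eq _ _ hX hZ]
    simp only [coeff_add, map_add, mul_add, smul_add, Finset.sum_add_distrib]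

private theorem smul_mul' (c : K) (X Y : PsiDO D) : (c • X) * Y = c • (X * Y) := by
  obtain ⟨N, hX⟩ := X.bdd
  obtain ⟨M, hY⟩ := Y.bdd
  have hcX : ∀ i, N < i → (c • X).coeff i = 0 := fun i hi => by simp [hX i hi]
  refine coeff_mul_ext hcX hY (fun i hi => ?_) fun s => ?_
  · simp [coeff_mul_eq_zero X Y hX hY i hi]
  · rw [coeff_smul, coeff_mul_eq _ _ hcX hY, coeff_mul_eq _ _ hX hY]
    simp only [coeff_smul, Finset.smul_sum, smul_mul_assoc]
    exact Finset.sum_congr rfl fun _ _ => Finset.sum_congr rfl fun _ _ => smul_comm _ _ _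

private theorem mul_smul' (c : K) (X Y : PsiDO D) : X * (c • Y) = c • (X * Y) := by
  obtain ⟨N, hX⟩ := X.bdd
  obtain ⟨M, hY⟩ := Y.bdd
  have hcY : ∀ i, M < i → (c • Y).coeff i = 0 := fun i hi => by simp [hY i hi]
  refine coeff_mul_ext hX hcY (fun i hi => ?_) fun s => ?_
  · simp [coeff_mul_eq_zero X Y hX hY i hi]
  · rw [coeff_smul, coeff_mul_eq _ _ hX hcY, coeff_mul_eq _ _ hX hY]
    simp only [coeff_smul, Finset.smul_sum, map_smul, mul_smul_comm]
    exact Finset.sum_congr rfl fun _ _ => Finset.sum_congr rfl fun _ _ => smul_comm _ _ _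

private theorem mul_assoc' (X Y Z : PsiDO D) : X * Y * Z = X * (Y * Z) := by
  obtain ⟨N, hX⟩ := X.bdd
  obtain ⟨M, hY⟩ := Y.bdd
  obtain ⟨Q, hZ⟩ := Z.bdd
  have hXY := coeff_mul_eq_zero X Y hX hY
  have hYZ := coeff_mul_eq_zero Y Z hY hZ
  refine coeff_mul_ext hXY hZ
    (fun i hi => coeff_mul_eq_zero X _ hX hYZ i (by omega)) fun s => ?_
  rw [coeff_mul_eq _ _ hXY hZ, add_assoc N M Q, coeff_mul_eq _ _ hX hYZ]
  simp only [coeff_mul_eq _ _ hX hY, coeff_mul_eq _ _ hY hZ, map_sum, map_zsmul,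
    NCDeriv.iter_mul, NCDeriv.iter_iter, Finset.smul_sum, Finset.sum_mul, Finset.mul_sum]
  have key : ∀ (a p b l k : ℕ), a + b + l = p →
      Ring.choose (N + M - (p : ℤ)) k =
        ∑ m ∈ Finset.HasAntidiagonal.antidiagonal k,
          Ring.choose (N - (a : ℤ) - l) m.1 * Ring.choose (M - (b : ℤ)) m.2 := by
    intro a p b l k h
    rw [← Ring.add_choose_eq k (Commute.all _ _)]
    congr 1
    omega
  have hL : ∀ p ∈ Finset.HasAntidiagonal.antidiagonal s, ∀ q ∈ Finset.HasAntidiagonal.antidiagonal p.2,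
      ∀ x ∈ Finset.HasAntidiagonal.antidiagonal p.1, ∀ y ∈ Finset.HasAntidiagonal.antidiagonal x.2,
      Ring.choose (N + M - (p.1 : ℤ)) q.2 •
        (Ring.choose (N - (x.1 : ℤ)) y.2 •
          (X.coeff (N - x.1) * D.iter y.2 (Y.coeff (M - y.1))) *
            D.iter q.2 (Z.coeff (Q - q.1))) =
      ∑ m ∈ Finset.HasAntidiagonal.antidiagonal q.2,
        (Ring.choose (N - (x.1 : ℤ) - y.2) m.1 * Ring.choose (M - (y.1 : ℤ)) m.2 *
          Ring.choose (N - (x.1 : ℤ)) y.2) •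
        (X.coeff (N - x.1) * D.iter y.2 (Y.coeff (M - y.1)) *
            D.iter q.2 (Z.coeff (Q - q.1))) := by
    intro p hp q hq x hx y hy
    simp only [Finset.HasAntidiagonal.mem_antidiagonal] at hp hq hx hy
    rw [key x.1 p.1 y.1 y.2 q.2 (by omega), Finset.sum_smul]
    refine Finset.sum_congr rfl fun m _ => ?_
    rw [smul_mul_assoc, smul_smul]
  rw [Finset.sum_congr rfl fun p hp => Finset.sum_congr rfl fun q hq =>
    Finset.sum_congr rfl fun x hx => Finset.sum_congr rfl fun y hy => hL p hp q hq x hx y hy]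
  have hR : ∀ (x q y r m : ℕ × ℕ), m ∈ Finset.HasAntidiagonal.antidiagonal q.2 →
      Ring.choose (N - (x.1 : ℤ)) q.2 •
        (X.coeff (N - x.1) * Ring.choose (M - (y.1 : ℤ)) r.2 •
          (q.2.choose m.1 • (D.iter m.1 (Y.coeff (M - y.1)) *
            D.iter (m.2 + r.2) (Z.coeff (Q - r.1))))) =
        (Ring.choose (N - (x.1 : ℤ) - m.1) m.2 * Ring.choose (M - (y.1 : ℤ)) r.2 *
          Ring.choose (N - (x.1 : ℤ)) m.1) •
        (X.coeff (N - x.1) * D.iter m.1 (Y.coeff (M - y.1)) *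
            D.iter (m.2 + r.2) (Z.coeff (Q - r.1))) := by
    intro x q y r m hm
    simp only [Finset.HasAntidiagonal.mem_antidiagonal] at hm
    have hc := Ring.choose_smul_choose (N - (x.1 : ℤ)) (n := q.2) (k := m.1) (by omega)
    rw [show q.2 - m.1 = m.2 by omega] at hc
    rw [← natCast_zsmul, mul_smul_comm, mul_smul_comm, smul_smul, smul_smul, ← mul_assoc]
    congr 1
    rw [nsmul_eq_mul] at hc
    linear_combination Ring.choose (M - (y.1 : ℤ)) r.2 * hc
  simp only [Finset.sum_sigma']
  refine Finset.sum_nbij'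
    (fun z => ⟨(z.2.2.1.1, z.2.2.2.1.1 + z.2.1.1 + z.2.2.2.2.2 + z.2.2.2.1.2 + z.2.2.2.2.1),
      ⟨(z.2.2.2.1.1 + z.2.1.1 + z.2.2.2.2.2, z.2.2.2.1.2 + z.2.2.2.2.1),
      ⟨(z.2.2.2.1.1, z.2.1.1 + z.2.2.2.2.2), ⟨(z.2.1.1, z.2.2.2.2.2),
      (z.2.2.2.1.2, z.2.2.2.2.1)⟩⟩⟩⟩)
    (fun w => ⟨(w.1.1 + w.2.2.1.1 + w.2.2.2.2.1,
        w.2.2.2.1.1 + w.2.2.2.2.2 + w.2.2.2.1.2),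
      ⟨(w.2.2.2.1.1, w.2.2.2.2.2 + w.2.2.2.1.2),
      ⟨(w.1.1, w.2.2.1.1 + w.2.2.2.2.1), ⟨(w.2.2.1.1, w.2.2.2.2.1),
      (w.2.2.2.2.2, w.2.2.2.1.2)⟩⟩⟩⟩) ?_ ?_ ?_ ?_ ?_
  · rintro ⟨⟨p1, p2⟩, ⟨q1, q2⟩, ⟨x1, x2⟩, ⟨y1, y2⟩, ⟨m1, m2⟩⟩ h
    simp only [Finset.mem_sigma, Finset.HasAntidiagonal.mem_antidiagonal] at h ⊢
    obtain ⟨h1, h2, h3, h4, h5⟩ := h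
    refine ⟨?_, ?_, ?_, ?_, ?_⟩ <;> (try dsimp only at *) <;> omega
  · rintro ⟨⟨p1, p2⟩, ⟨q1, q2⟩, ⟨x1, x2⟩, ⟨y1, y2⟩, ⟨m1, m2⟩⟩ h
    simp only [Finset.mem_sigma, Finset.HasAntidiagonal.mem_antidiagonal] at h ⊢
    obtain ⟨h1, h2, h3, h4, h5⟩ := h
    refine ⟨?_, ?_, ?_, ?_, ?_⟩ <;> (try dsimp only at *) <;> omega
  · rintro ⟨⟨p1, p2⟩, ⟨q1, q2⟩, ⟨x1, x2⟩, ⟨y1, y2⟩, ⟨m1, m2⟩⟩ h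
    simp only [Finset.mem_sigma, Finset.HasAntidiagonal.mem_antidiagonal] at h
    obtain ⟨h1, h2, h3, h4, h5⟩ := h
    simp only [Sigma.mk.injEq, Prod.mk.injEq, heq_eq_eq, and_true, true_and]
    repeat' apply And.intro
    all_goals first | rfl | omega
  · rintro ⟨⟨p1, p2⟩, ⟨q1, q2⟩, ⟨x1, x2⟩, ⟨y1, y2⟩, ⟨m1, m2⟩⟩ h
    simp only [Finset.mem_sigma, Finset.HasAntidiagonal.mem_antidiagonal] at h
    obtain ⟨h1, h2, h3, h4, h5⟩ := h
    simp only [Sigma.mk.injEq, Prod.mk.injEq, heq_eq_eq, and_true, true_and]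
    repeat' apply And.intro
    all_goals first | rfl | omega
  · rintro ⟨⟨p1, p2⟩, ⟨q1, q2⟩, ⟨x1, x2⟩, ⟨y1, y2⟩, ⟨m1, m2⟩⟩ h
    simp only [Finset.mem_sigma, Finset.HasAntidiagonal.mem_antidiagonal] at h
    dsimp only at h ⊢
    obtain ⟨h1, h2, h3, h4, rfl⟩ := h
    have := hR (x1, y1 + q1 + m2 + y2 + m1) (y1 + q1 + m2, y2 + m1) (y1, q1 + m2)
      (q1, m2) (y2, m1) (by simp)
    exact this.symm

/-- The (associative, unital) ring of formal pseudo-differential operators. -/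
noncomputable instance : Ring (PsiDO D) :=
  { (inferInstance : AddCommGroup (PsiDO D)), (inferInstance : Mul (PsiDO D)),
    (inferInstance : One (PsiDO D)) with
    left_distrib := mul_add'
    right_distrib := add_mul'
    zero_mul := fun X => by simpa using smul_mul' (0 : K) X X
    mul_zero := fun X => by simpa using mul_smul' (0 : K) X X
    mul_assoc := mul_assoc'
    one_mul := one_mul'
    mul_one := mul_one' }

noncomputable instance : Algebra K (PsiDO D) := Algebra.ofModule smul_mul' mul_smul'

/-- The projection `X ↦ X_{≥ 0}` onto the part with non-negative powers of `∂`. -/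
def pos : PsiDO D →ₗ[K] PsiDO D where
  toFun X := mk (fun i => if 0 ≤ i then X.coeff i else 0) (by
    obtain ⟨N, hN⟩ := X.bdd
    exact ⟨N, fun i hi => by simp [hN i hi]⟩)
  map_add' X Y := by
    ext i
    simp only [coeff_mk, coeff_add]
    split_ifs <;> simp
  map_smul' c X := by
    ext i
    simp only [coeff_mk, coeff_smul, RingHom.id_apply]
    split_ifs <;> simp

/-- The projection `X ↦ X_{< 0}` onto the part with negative powers of `∂`. -/
def neg : PsiDO D →ₗ[K] PsiDO D where
  toFun X := mk (fun i => if i < 0 then X.coeff i else 0) (by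
    obtain ⟨N, hN⟩ := X.bdd
    exact ⟨N, fun i hi => by simp [hN i hi]⟩)
  map_add' X Y := by
    ext i
    simp only [coeff_mk, coeff_add]
    split_ifs <;> simp
  map_smul' c X := by
    ext i
    simp only [coeff_mk, coeff_smul, RingHom.id_apply]
    split_ifs <;> simp

@[simp] theorem coeff_pos (X : PsiDO D) (i : ℤ) :
    (pos X).coeff i = if 0 ≤ i then X.coeff i else 0 := rfl

@[simp] theorem coeff_neg_part (X : PsiDO D) (i : ℤ) :
    (neg X).coeff i = if i < 0 then X.coeff i else 0 := rfl

theorem neg_eq_sub_pos (X : PsiDO D) : neg X = X - pos X := by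
  ext i
  simp only [coeff_neg_part, coeff_sub, coeff_pos]
  by_cases h : i < 0
  · simp [h, not_le.mpr h]
  · simp [h, not_lt.mp h]

/-- The operator `∂`. -/
def del : PsiDO D := monomial 1 1

/-- The operator `∂⁻¹`. -/
def delInv : PsiDO D := monomial (-1) 1

theorem monomial_mul_monomial_one (i j : ℤ) (a : A) :
    (monomial i a * monomial j 1 : PsiDO D) = monomial (i + j) a := by
  ext n
  rw [coeff_mul, finsum_eq_single _ (i, 0)]
  · have : n - i = j ↔ n = i + j := by omega
    simp [NCDeriv.iter_zero, this]
  · rintro ⟨i', k⟩ h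
    by_cases hi : i' = i
    · subst hi
      have hk : k ≠ 0 := by rintro rfl; exact h rfl
      simp only [coeff_monomial]
      split_ifs <;> simp [D.iter_one k hk]
    · simp [hi]

theorem del_mul_delInv : (del * delInv : PsiDO D) = 1 := monomial_mul_monomial_one _ _ _

theorem delInv_mul_del : (delInv * del : PsiDO D) = 1 := monomial_mul_monomial_one _ _ _

end PsiDO
end PsiDO

/-! ### The algebra generated by the generic Lax operator -/

/-- The free algebra on the symbols `u_{n+2}^{(j)}`, indexed by `(n, j) : ℕ × ℕ`: the
noncommutative differential polynomials in `u_2, u_3, …`. -/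
abbrev DiffPoly (K : Type*) [Field K] : Type _ := FreeAlgebra K (ℕ × ℕ)

namespace DiffPoly

variable (K : Type*) [Field K]

/-- The algebra homomorphism `f ↦ f + ε f_x` into the dual numbers over `DiffPoly K`. -/
noncomputable def dxAux : DiffPoly K →ₐ[K] TrivSqZeroExt (DiffPoly K) (DiffPoly K) :=
  FreeAlgebra.lift K fun p =>
    TrivSqZeroExt.inl (FreeAlgebra.ι K p) + TrivSqZeroExt.inr (FreeAlgebra.ι K (p.1, p.2 + 1))

theorem fst_dxAux (f : DiffPoly K) : (dxAux K f).fst = f := by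
  have h : (TrivSqZeroExt.fstHom K (DiffPoly K) (DiffPoly K)).comp (dxAux K) =
      AlgHom.id K (DiffPoly K) := by
    ext p
    simp [dxAux]
  exact DFunLike.congr_fun h f

/-- The total derivative `∂_x`: the derivation with `∂_x u_{n+2}^{(j)} = u_{n+2}^{(j+1)}`. -/
noncomputable def dx : NCDeriv K (DiffPoly K) where
  toLin :=
    { toFun := fun f => (dxAux K f).snd
      map_add' := fun f g => by simp
      map_smul' := fun c f => by simp }
  leibniz := fun f g => by
    simp [fst_dxAux, add_comm]

theorem dx_ι (p : ℕ × ℕ) :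
    (dx K).toLin (FreeAlgebra.ι K p) = FreeAlgebra.ι K (p.1, p.2 + 1) := by
  simp [dx, dxAux]

end DiffPoly

namespace KP

variable (K : Type*) [Field K]

/-- Formal pseudo-differential operators over the noncommutative differential polynomials. -/
abbrev Psi : Type _ := PsiDO (DiffPoly.dx K)

/-- The generic Lax operator `∂ + ∑_{n ≥ 1} u_{n+1} ∂^{-n}`. -/
noncomputable def laxOp : Psi K :=
  PsiDO.mk (fun i =>
      if i = 1 then 1 else if i < 0 then FreeAlgebra.ι K ((-i - 1).toNat, 0) else 0)
    ⟨1, fun i hi => by rw [if_neg (by omega), if_neg (by omega)]⟩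

/-- The `K`-algebra `R`: the smallest subalgebra of the algebra of pseudo-differential operators
which contains `L` and `∂⁻¹` and is closed under the projection `( )_{≥ 0}` (and hence
contains `∂ = L_{≥ 0}` and is closed under `( )_{< 0}`). -/
noncomputable def algR : Subalgebra K (Psi K) :=
  sInf {S | laxOp K ∈ S ∧ PsiDO.delInv ∈ S ∧ ∀ X ∈ S, PsiDO.pos X ∈ S}

theorem laxOp_mem : laxOp K ∈ algR K := Algebra.mem_sInf.mpr fun _ hS => hS.1

theorem delInv_mem : PsiDO.delInv ∈ algR K := Algebra.mem_sInf.mpr fun _ hS => hS.2.1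

theorem pos_mem {X : Psi K} (hX : X ∈ algR K) : PsiDO.pos X ∈ algR K :=
  Algebra.mem_sInf.mpr fun S hS => hS.2.2 X (Algebra.mem_sInf.mp hX S hS)

theorem neg_mem {X : Psi K} (hX : X ∈ algR K) : PsiDO.neg X ∈ algR K := by
  rw [PsiDO.neg_eq_sub_pos]
  exact sub_mem hX (pos_mem K hX)

/-- `L` as an element of `R`. -/
noncomputable def L : algR K := ⟨laxOp K, laxOp_mem K⟩

/-- The projection `( )_{≥ 0}` of `R`. -/
noncomputable def posR : algR K →ₗ[K] algR K :=
  (PsiDO.pos.comp (algR K).toSubmodule.subtype).codRestrict (algR K).toSubmodule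
    fun X => pos_mem K X.2

/-- The projection `( )_{< 0}` of `R`. -/
noncomputable def negR : algR K →ₗ[K] algR K :=
  (PsiDO.neg.comp (algR K).toSubmodule.subtype).codRestrict (algR K).toSubmodule
    fun X => neg_mem K X.2

theorem posR_add_negR (X : algR K) : posR K X + negR K X = X := by
  apply Subtype.ext
  change PsiDO.pos X.1 + PsiDO.neg X.1 = X.1
  rw [PsiDO.neg_eq_sub_pos]
  abel

/-! ### The algebra `A(P)` and the map `ℓ` -/

/-- The two basic products `≺` and `•`. -/
inductive Op
  | prec
  | bullet

/-- The algebra `A(P)` generated by one element `P` with two products `≺`, `•` satisfying the four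
associativity laws `(α ∘₁ β) ∘₂ γ = α ∘₁ (β ∘₂ γ)`, `∘₁, ∘₂ ∈ {≺, •}`. It has as a basis the
expressions `P ∘₁ P ∘₂ ⋯ ∘ₛ P`; such an expression is recorded by the list `[∘₁, …, ∘ₛ]`. -/
abbrev AP : Type _ := List Op →₀ K

namespace AP

/-- The bilinear product given on basis elements by `(P ⋯ P) ∘ (P ⋯ P) = P ⋯ P ∘ P ⋯ P`. -/
noncomputable def mulOp (o : Op) : AP K →ₗ[K] AP K →ₗ[K] AP K :=
  Finsupp.lift _ K _ fun s => Finsupp.lift _ K _ fun t => Finsupp.single (s ++ o :: t) 1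

/-- The generator `P`. -/
noncomputable def P : AP K := Finsupp.single [] 1

variable {K}

/-- `α ≺ β`. -/
noncomputable def prec (α β : AP K) : AP K := mulOp K Op.prec α β

/-- `α • β`. -/
noncomputable def bullet (α β : AP K) : AP K := mulOp K Op.bullet α β

/-- `α ≻ β = α ≺ β + α • β`. -/
noncomputable def succ (α β : AP K) : AP K := prec α β + bullet α β

variable (K)

/-- `powP n` is `P_{n+1}`, the `(n+1)`-fold `•`-power of `P`. -/
noncomputable def powP : ℕ → AP K
  | 0 => P K
  | n + 1 => bullet (powP n) (P K)

/-- `Pw m [m₁, …, mₖ]` is `P_m ≺ P_{m₁} ≺ ⋯ ≺ P_{mₖ}`, where `P_n` is the `n`-th `•`-power of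
`P`. -/
noncomputable def Pw : ℕ+ → List ℕ+ → AP K
  | m, [] => powP K m.natPred
  | m, n :: w => prec (powP K m.natPred) (Pw n w)

theorem mulOp_single (o : Op) (s t : List Op) (a b : K) :
    mulOp K o (Finsupp.single s a) (Finsupp.single t b) =
      Finsupp.single (s ++ o :: t) (a * b) := by
  simp [mulOp, Finsupp.smul_single]

theorem mulOp_assoc (o o' : Op) (α β γ : AP K) :
    mulOp K o' (mulOp K o α β) γ = mulOp K o α (mulOp K o' β γ) := by
  induction α using Finsupp.induction_linear with
  | zero => simp
  | add α α' h h' => simp [h, h']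
  | single s a =>
    induction β using Finsupp.induction_linear with
    | zero => simp
    | add β β' h h' => simp [h, h']
    | single t b =>
      induction γ using Finsupp.induction_linear with
      | zero => simp
      | add γ γ' h h' => simp [h, h']
      | single r c => simp only [mulOp_single, mul_assoc, List.append_assoc, List.cons_append]

end AP

/-- `ℓ` on basis elements, by recursion on the number of products, from the right. -/
noncomputable def ellBasis (s : List Op) : algR K :=
  s.foldl (fun X o => match o with
    | Op.prec => -(negR K X * L K)
    | Op.bullet => X * L K) (L K)

/-- The linear map `ℓ : A(P) → R`. It is the unique one with `ℓ(P) = L`,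
`ℓ(α ≺ P) = -ℓ(α)_{<0} L` and `ℓ(α ≻ P) = ℓ(α)_{≥0} L`; see the four facts below. -/
noncomputable def ell : AP K →ₗ[K] algR K := Finsupp.lift _ K _ (ellBasis K)

theorem ell_single (s : List Op) (a : K) : ell K (Finsupp.single s a) = a • ellBasis K s := by
  simp [ell]

theorem ell_P : ell K (AP.P K) = L K := by
  simp [AP.P, ell_single, ellBasis]

theorem ell_prec_P (α : AP K) : ell K (AP.prec α (AP.P K)) = -(negR K (ell K α) * L K) := by
  unfold AP.prec
  induction α using Finsupp.induction_linear with
  | zero => simp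
  | add α β h h' => simp only [map_add, LinearMap.add_apply, h, h', add_mul, neg_add]
  | single s a =>
    rw [AP.P, AP.mulOp_single, ell_single, ell_single]
    simp [ellBasis]

theorem ell_bullet_P (α : AP K) : ell K (AP.bullet α (AP.P K)) = ell K α * L K := by
  unfold AP.bullet
  induction α using Finsupp.induction_linear with
  | zero => simp
  | add α β h h' => simp only [map_add, LinearMap.add_apply, h, h', add_mul]
  | single s a =>
    rw [AP.P, AP.mulOp_single, ell_single, ell_single]
    simp [ellBasis]

theorem ell_succ_P (α : AP K) : ell K (AP.succ α (AP.P K)) = posR K (ell K α) * L K := by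
  rw [AP.succ, map_add, ell_prec_P, ell_bullet_P]
  nth_rw 2 [← posR_add_negR K (ell K α)]
  rw [add_mul]
  abel

theorem ell_unique (f : AP K →ₗ[K] algR K) (hP : f (AP.P K) = L K)
    (hprec : ∀ α, f (AP.prec α (AP.P K)) = -(negR K (f α) * L K))
    (hsucc : ∀ α, f (AP.succ α (AP.P K)) = posR K (f α) * L K) : f = ell K := by
  have hb : ∀ α, f (AP.bullet α (AP.P K)) = f α * L K := by
    intro α
    have h := hsucc α
    rw [AP.succ, map_add, hprec] at h
    conv_rhs => rw [← posR_add_negR K (f α), add_mul, ← h]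
    abel
  refine Finsupp.lhom_ext' fun s => LinearMap.ext_ring ?_
  simp only [LinearMap.comp_apply, Finsupp.lsingle_apply]
  induction s using List.reverseRecOn with
  | nil => exact hP.trans (ell_P K).symm
  | append_singleton s o ih =>
    have h : (Finsupp.single (s ++ [o]) 1 : AP K) =
        AP.mulOp K o (Finsupp.single s 1) (AP.P K) := by
      rw [AP.P, AP.mulOp_single, mul_one]
    rw [h]
    cases o with
    | prec => exact (hprec _).trans (by rw [ih]; exact (ell_prec_P K _).symm)
    | bullet => exact (hb _).trans (by rw [ih]; exact (ell_bullet_P K _).symm)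

/-- `L^{m₁, …, mₖ} = ℓ(P_{m₁…mₖ})` for a nonempty word (and, as a convention that is never used,
`0` for the empty word). -/
noncomputable def Lw : List ℕ+ → algR K
  | [] => 0
  | m :: w => ell K (AP.Pw K m w)

/-! ### The generalized derivations -/

/-- A family of linear operators `δ_{m₁…mₖ}` on `R`, indexed by words of positive integers, is
the family of generalized derivations if it satisfies these rules, which determine it
recursively. For `w = m₁…mₖ` and `j`, `w.take j = m₁…mⱼ` and `w.drop j = mⱼ₊₁…mₖ`. -/
structure IsGenDer (δ : List ℕ+ → Module.End K (algR K)) : Prop where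
  nil : δ [] = 1
  lax : ∀ w, w ≠ [] → δ w (L K) = -⁅negR K (Lw K w), L K⁆ +
    ∑ j ∈ Finset.Ico 1 w.length, δ (w.take j) (L K) * negR K (Lw K (w.drop j))
  proj : ∀ w X, δ w (posR K X) = posR K (δ w X)
  mul : ∀ w X Y, δ w (X * Y) =
    ∑ j ∈ Finset.range (w.length + 1), δ (w.take j) X * δ (w.drop j) Y

/-- `ϑ_{mn} = (δ_{mn} - δ_{nm}) / 2`. -/
noncomputable def theta (δ : List ℕ+ → Module.End K (algR K)) (m n : ℕ+) :
    Module.End K (algR K) :=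
  (2⁻¹ : K) • (δ [m, n] - δ [n, m])

/-- `W^{(m,n)} = (L^{m,n} - L^{n,m})_{≥ 0} / 2`. -/
noncomputable def W (m n : ℕ+) : algR K :=
  (2⁻¹ : K) • posR K (Lw K [m, n] - Lw K [n, m])

end KP

/-! Collect the operators into one generating series E(X) = ∑ (δ_w X) w in noncommuting letters. The
generalized Leibniz rule says exactly that E is multiplicative, so a family of generalized
derivations is a ring homomorphism from R to series over R, compatible with the projections
(`IsGenDer.toHom`).

Put N = ∑ (L^w)_{<0} w, P = ∑ (L^w)_{≥0} w and C = ∑ Lⁿ n. The recursion defining ℓ amounts to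
L^{wn} = -(L^w)_{<0} Lⁿ, which is the factorization (1 - N)(1 + C) = 1 + P (`factorization`). The
generalized Lax equations amount to the dressing relation E(L)(1 - N) = (1 - N) L
(`mul_one_sub_negSeries`). Multiplying it by 1 + C, which commutes with L, gives the same relation
with 1 + P, that is, the second form of the flows (`lax_eq_pos`).

Commutativity on L (`coeff_comm_of_dressing`): with a second, independent set of letters, E applied
twice conjugates L by G = E(1 - N) (1 - N), one factor in each set. With U the product of the two
copies of 1 + C, GU is the product of E(1 + P) and 1 + P, hence non-negative, while G - 1 is
negative. Powers of L commute, so U is symmetric under exchange of the two sets. Then G minus its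
exchange is negative and becomes non-negative after multiplication by U, whose constant term is 1,
so it vanishes. Thus G is symmetric, and so is the twofold action on L.

The operators annihilate ∂ = L_{≥0} and therefore ∂⁻¹; since R is generated by L and ∂⁻¹ under the
algebra operations and the projection, commutativity and uniqueness both reduce to L.

Existence: the recursion is solved for elements `laxFlow` of R, which are negative for nonempty
words. As the symbols u are free, their images can be read off from the coefficients of these
elements and extended to a homomorphism that commutes with ∂_x. Acting on coefficients, it respects
the product of pseudo-differential operators, sends L to `laxFlow`, and preserves R. -/

/-! ### Noncommutative formal power series -/

/-- Formal power series in noncommuting variables indexed by `α`, with coefficients in `A`. -/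
@[ext] structure WordSeries (α A : Type*) where
  coeff : List α → A

namespace WordSeries

variable {α A B : Type*}

instance : CoeFun (WordSeries α A) fun _ => List α → A := ⟨coeff⟩

@[simp] theorem mk_apply (f : List α → A) (w : List α) : (mk f) w = f w := rfl

theorem ext_apply {f g : WordSeries α A} (h : ∀ w, f w = g w) : f = g :=
  WordSeries.ext (funext h)

/-- The series `∑ f(xw) w`. -/
def tail (x : α) (f : WordSeries α A) : WordSeries α A := ⟨fun w => f (x :: w)⟩

@[simp] theorem tail_apply (x : α) (f : WordSeries α A) (w : List α) :
    tail x f w = f (x :: w) := rfl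

section AddCommGroup

variable [AddCommGroup A]

instance : Zero (WordSeries α A) := ⟨⟨fun _ => 0⟩⟩
instance : Add (WordSeries α A) := ⟨fun f g => ⟨fun w => f w + g w⟩⟩
instance : Neg (WordSeries α A) := ⟨fun f => ⟨fun w => -f w⟩⟩
instance : Sub (WordSeries α A) := ⟨fun f g => ⟨fun w => f w - g w⟩⟩

@[simp] theorem zero_apply (w : List α) : (0 : WordSeries α A) w = 0 := rfl
@[simp] theorem add_apply (f g : WordSeries α A) (w : List α) : (f + g) w = f w + g w := rfl
@[simp] theorem neg_apply (f : WordSeries α A) (w : List α) : (-f) w = -f w := rfl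
@[simp] theorem sub_apply (f g : WordSeries α A) (w : List α) : (f - g) w = f w - g w := rfl

instance : AddCommGroup (WordSeries α A) where
  add_assoc f g h := ext_apply fun w => by simp [add_assoc]
  zero_add f := ext_apply fun w => by simp
  add_zero f := ext_apply fun w => by simp
  add_comm f g := ext_apply fun w => by simp [add_comm]
  neg_add_cancel f := ext_apply fun w => by simp
  sub_eq_add_neg f g := ext_apply fun w => by simp [sub_eq_add_neg]
  nsmul := nsmulRec
  zsmul := zsmulRec

/-- The coefficient at a given word, as a homomorphism. -/
def coeffHom (A : Type*) [AddCommGroup A] (w : List α) : WordSeries α A →+ A where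
  toFun f := f w
  map_zero' := rfl
  map_add' _ _ := rfl

theorem sum_apply {ι : Type*} (s : Finset ι) (f : ι → WordSeries α A) (w : List α) :
    (∑ i ∈ s, f i) w = ∑ i ∈ s, f i w :=
  map_sum (coeffHom A w) f s

/-- The constant series. -/
def const (a : A) : WordSeries α A where
  coeff
    | [] => a
    | _ :: _ => 0

@[simp] theorem const_nil (a : A) : (const a : WordSeries α A) [] = a := rfl
@[simp] theorem const_cons (a : A) (x : α) (w : List α) :
    (const a : WordSeries α A) (x :: w) = 0 := rfl

theorem const_of_ne (a : A) {w : List α} (hw : w ≠ []) : (const a : WordSeries α A) w = 0 := by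
  cases w with
  | nil => exact absurd rfl hw
  | cons => rfl

/-- The series all of whose coefficients lie in `N`. -/
def coeffIn (α : Type*) (N : AddSubgroup A) : AddSubgroup (WordSeries α A) where
  carrier := {f | ∀ w, f w ∈ N}
  zero_mem' _ := N.zero_mem
  add_mem' hf hg w := N.add_mem (hf w) (hg w)
  neg_mem' hf w := N.neg_mem (hf w)

theorem const_mem_coeffIn {N : AddSubgroup A} {a : A} (ha : a ∈ N) :
    const a ∈ coeffIn α N := by
  rintro (_ | _)
  exacts [ha, N.zero_mem]

end AddCommGroup

variable [Ring A] [Ring B]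

instance : Mul (WordSeries α A) :=
  ⟨fun f g => ⟨fun w => ∑ j ∈ Finset.range (w.length + 1), f (w.take j) * g (w.drop j)⟩⟩

theorem mul_apply (f g : WordSeries α A) (w : List α) :
    (f * g) w = ∑ j ∈ Finset.range (w.length + 1), f (w.take j) * g (w.drop j) := rfl

@[simp] theorem mul_nil (f g : WordSeries α A) : (f * g) [] = f [] * g [] := by
  simp [mul_apply]

theorem mul_cons (f g : WordSeries α A) (x : α) (w : List α) :
    (f * g) (x :: w) = f [] * g (x :: w) + (tail x f * g) w := by
  rw [mul_apply, List.length_cons, Finset.sum_range_succ', add_comm]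
  rfl

theorem mul_apply_last (f g : WordSeries α A) (w : List α) :
    (f * g) w = ∑ j ∈ Finset.range w.length, f (w.take j) * g (w.drop j) + f w * g [] := by
  rw [mul_apply, Finset.sum_range_succ]
  simp

instance : One (WordSeries α A) := ⟨const 1⟩

theorem one_def : (1 : WordSeries α A) = const 1 := rfl
@[simp] theorem one_nil : (1 : WordSeries α A) [] = 1 := rfl

theorem add_mul_apply (f g h : WordSeries α A) (w : List α) :
    ((f + g) * h) w = (f * h) w + (g * h) w := by
  simp only [mul_apply, add_apply, add_mul, Finset.sum_add_distrib]

/-- Removing the first letter from a product gives `f [] * tail x g + tail x f * g`, so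
associativity follows by induction on the word with `f` varying. -/
theorem mul_assoc_apply (f g h : WordSeries α A) (w : List α) :
    (f * g * h) w = (f * (g * h)) w := by
  have hsmul (a : A) (f g : WordSeries α A) (w : List α) :
      ((⟨fun v => a * f v⟩ : WordSeries α A) * g) w = a * (f * g) w := by
    simp only [mul_apply, Finset.mul_sum, mul_assoc]
  induction w generalizing f with
  | nil => simp [mul_assoc]
  | cons x w ih =>
    have ht : tail x (f * g) = (⟨fun v => f [] * tail x g v⟩ : WordSeries α A) + tail x f * g := by
      refine ext_apply fun v => ?_
      exact mul_cons f g x v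
    rw [mul_cons, mul_cons, ht, add_mul_apply, ih, hsmul, mul_cons, mul_nil, mul_add, mul_assoc,
      add_assoc]

@[simp] theorem const_mul_apply (a : A) (f : WordSeries α A) (w : List α) :
    ((const a : WordSeries α A) * f) w = a * f w := by
  rw [mul_apply, Finset.sum_eq_single 0]
  · simp
  · intro j hj hj0
    rw [const_of_ne, zero_mul]
    intro h
    have := congrArg List.length h
    simp only [Finset.mem_range] at hj
    simp only [List.length_take, List.length_nil] at this
    omega
  · simp

@[simp] theorem mul_const_apply (a : A) (f : WordSeries α A) (w : List α) :
    (f * (const a : WordSeries α A)) w = f w * a := by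
  rw [mul_apply_last, Finset.sum_eq_zero, zero_add, const_nil]
  intro j hj
  rw [const_of_ne, mul_zero]
  intro h
  have := congrArg List.length h
  simp only [Finset.mem_range] at hj
  simp only [List.length_drop, List.length_nil] at this
  omega

instance : Ring (WordSeries α A) :=
  { (inferInstance : AddCommGroup (WordSeries α A)), (inferInstance : Mul (WordSeries α A)),
    (inferInstance : One (WordSeries α A)) with
    left_distrib := fun f g h => by
      refine ext_apply fun w => ?_
      simp only [mul_apply, add_apply, mul_add, Finset.sum_add_distrib]
    right_distrib := fun f g h => ext_apply (add_mul_apply f g h)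
    zero_mul := fun f => by refine ext_apply fun w => ?_; simp [mul_apply]
    mul_zero := fun f => by refine ext_apply fun w => ?_; simp [mul_apply]
    mul_assoc := fun f g h => ext_apply (mul_assoc_apply f g h)
    one_mul := fun f => by refine ext_apply fun w => ?_; rw [one_def, const_mul_apply, one_mul]
    mul_one := fun f => by refine ext_apply fun w => ?_; rw [one_def, mul_const_apply, mul_one] }

/-- The embedding of the coefficients as constant series. -/
def constHom (α A : Type*) [Ring A] : A →+* WordSeries α A where
  toFun := const
  map_one' := rfl
  map_zero' := by refine ext_apply fun w => ?_; cases w <;> rfl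
  map_add' a b := by refine ext_apply fun w => ?_; cases w <;> simp
  map_mul' a b := by refine ext_apply fun w => ?_; cases w <;> simp

@[simp] theorem constHom_apply (a : A) : constHom α A a = const a := rfl

/-- A homomorphism applied to all coefficients. -/
def map (φ : A →+* B) : WordSeries α A →+* WordSeries α B where
  toFun f := ⟨fun w => φ (f w)⟩
  map_one' := by refine ext_apply fun w => ?_; cases w <;> simp [one_def]
  map_zero' := by refine ext_apply fun w => ?_; simp
  map_add' f g := by refine ext_apply fun w => ?_; simp
  map_mul' f g := by refine ext_apply fun w => ?_; simp [mul_apply]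

@[simp] theorem map_apply (φ : A →+* B) (f : WordSeries α A) (w : List α) :
    map φ f w = φ (f w) := rfl

theorem map_const (φ : A →+* B) (a : A) :
    map φ (const a : WordSeries α A) = const (φ a) := by
  refine ext_apply fun w => ?_
  cases w <;> simp

/-- The exchange of two mutually commuting sets of variables. -/
def swap : WordSeries α (WordSeries α A) →+* WordSeries α (WordSeries α A) where
  toFun f := ⟨fun v => ⟨fun w => f w v⟩⟩
  map_one' := by refine ext_apply fun v => ext_apply fun w => ?_; cases v <;> cases w <;> rfl
  map_zero' := rfl
  map_add' _ _ := rfl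
  map_mul' f g := by
    refine ext_apply fun v => ext_apply fun w => ?_
    simp only [mul_apply, sum_apply]
    exact Finset.sum_comm

@[simp] theorem swap_apply (f : WordSeries α (WordSeries α A)) (v w : List α) :
    swap f v w = f w v := rfl

theorem swap_const (f : WordSeries α A) : swap (const f) = map (constHom α A) f := by
  refine ext_apply fun v => ext_apply fun w => ?_
  cases w <;> simp

theorem swap_map_const (f : WordSeries α A) : swap (map (constHom α A) f) = const f := by
  refine ext_apply fun v => ext_apply fun w => ?_
  cases v <;> simp

theorem mul_mem_coeffIn {N : AddSubgroup A} (hN : ∀ a ∈ N, ∀ b ∈ N, a * b ∈ N) :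
    ∀ f ∈ coeffIn α N, ∀ g ∈ coeffIn α N, f * g ∈ coeffIn α N := by
  intro f hf g hg w
  rw [mul_apply]
  exact sum_mem fun j _ => hN _ (hf (w.take j)) _ (hg (w.drop j))

theorem one_mem_coeffIn {N : AddSubgroup A} (hN : (1 : A) ∈ N) : 1 ∈ coeffIn α N :=
  const_mem_coeffIn hN

/-! ### Cancellation and the dressing argument -/

/-- Right multiplication by a series `u` inherits from its constant term the property of mapping
no nonzero element of `N` into `Q`. -/
theorem eq_zero_of_mul_mem {N Q : AddSubgroup A} (u : WordSeries α A)
    (hu : ∀ a ∈ N, a * u [] ∈ Q → a = 0) :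
    ∀ f ∈ coeffIn α N, f * u ∈ coeffIn α Q → f = 0 := by
  intro f hf hfu
  -- Once the coefficients of `f` at all shorter words vanish, the coefficient of `f * u` at `w` is
  -- just `f w * u []`.
  have key (n : ℕ) : ∀ w : List α, w.length = n → f w = 0 := by
    induction n using Nat.strong_induction_on with
    | _ n ih =>
      rintro w rfl
      have h := hfu w
      rw [mul_apply_last, Finset.sum_eq_zero, zero_add] at h
      · exact hu _ (hf w) h
      · intro j hj
        rw [Finset.mem_range] at hj
        rw [ih j hj _ (by rw [List.length_take]; omega), zero_mul]
  exact ext_apply fun w => key _ w rfl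

/-- Let `E` be a homomorphism into series which is given on `L` by conjugation with the negative
factor `1 - N` of the factorization `1 + C = (1 - N)⁻¹ (1 + P)` of a series `C` in powers of `L`.
Then the coefficients of `E` commute on `L`. -/
theorem coeff_comm_of_dressing (E : A →+* WordSeries α A)
    {Neg Pos : AddSubgroup A} (hdisj : ∀ a ∈ Neg, a ∈ Pos → a = 0)
    (hneg : ∀ a ∈ Neg, ∀ b ∈ Neg, a * b ∈ Neg) (hpos : ∀ a ∈ Pos, ∀ b ∈ Pos, a * b ∈ Pos)
    (hone : 1 ∈ Pos) (hEneg : ∀ a ∈ Neg, E a ∈ coeffIn α Neg)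
    (hEpos : ∀ a ∈ Pos, E a ∈ coeffIn α Pos) {L : A} {N P C : WordSeries α A}
    (hN : N ∈ coeffIn α Neg) (hP : P ∈ coeffIn α Pos) (hN0 : N [] = 0) (hC0 : C [] = 0)
    (hC : ∀ w, C w = 0 ∨ ∃ n : ℕ, C w = L ^ n)
    (hL : E L * (1 - N) = (1 - N) * const L) (hfac : (1 - N) * (1 + C) = 1 + P)
    (v w : List α) : E (E L w) v = E (E L v) w := by
  let c := constHom α A
  let cc := constHom α (WordSeries α A)
  -- the product of the two dressing operators
  set G := map E (1 - N) * cc (1 - N) with hG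
  set U := (1 + map c C) * (1 + cc C) with hU
  -- The dressing relation passes from L to its powers, hence to every coefficient of `C`. The outer
  -- word indexes `C`, the inner one `1 - N`.
  have hmapC : map E C * cc (1 - N) = cc (1 - N) * map c C := by
    refine ext_apply fun u => ?_
    simp only [cc, c, constHom_apply, mul_const_apply, const_mul_apply, map_apply]
    rcases hC u with h | ⟨n, h⟩
    · rw [h, map_zero, ← constHom_apply, map_zero, zero_mul, mul_zero]
    · rw [h, map_pow, ← constHom_apply, map_pow]
      exact (SemiconjBy.pow_right (a := 1 - N) hL.symm n).symm
  have hcomm : map c C * cc C = cc C * map c C := by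
    refine ext_apply fun u => ext_apply fun u' => ?_
    simp only [cc, c, constHom_apply, mul_const_apply, const_mul_apply, map_apply]
    rcases hC u with h | ⟨n, h⟩
    · simp [h]
    rcases hC u' with h' | ⟨n', h'⟩
    · simp [h']
    · rw [h, h', ← pow_add, ← pow_add, add_comm]
  have hswapU : swap U = U := by
    simp only [hU, map_mul, map_add, map_one, cc, c, constHom_apply, swap_const, swap_map_const]
    simp only [cc, c, constHom_apply] at hcomm
    simp only [mul_add, add_mul, mul_one, one_mul, hcomm]
    abel
  -- Moving `1 + C` in the outer letters to the left past `1 - N` in the inner ones turns it into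
  -- its image under `E`; then each pair of factors is an instance of the factorization.
  have hGU : G * U = map E (1 + P) * cc (1 + P) := by
    have h1 : cc (1 - N) * (1 + map c C) = (1 + map E C) * cc (1 - N) := by
      rw [mul_add, add_mul, hmapC, mul_one, one_mul]
    calc G * U = map E (1 - N) * (cc (1 - N) * (1 + map c C)) * (1 + cc C) := by
          simp only [hG, hU, mul_assoc]
      _ = map E (1 - N) * (1 + map E C) * (cc (1 - N) * (1 + cc C)) := by
          rw [h1]; simp only [mul_assoc]
      _ = map E ((1 - N) * (1 + C)) * cc ((1 - N) * (1 + C)) := by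
          simp only [map_mul, map_add, map_one]
      _ = _ := by rw [hfac]
  have hGpos : G * U ∈ coeffIn α (coeffIn α Pos) := by
    have h1 : (1 : WordSeries α A) ∈ coeffIn α Pos := one_mem_coeffIn hone
    rw [hGU, map_add, map_one]
    refine mul_mem_coeffIn (mul_mem_coeffIn hpos) _
      (add_mem (one_mem_coeffIn h1) fun u => hEpos _ (hP u)) _
      (const_mem_coeffIn (add_mem h1 hP))
  have hGneg : G - 1 ∈ coeffIn α (coeffIn α Neg) := by
    have h1 : map E N ∈ coeffIn α (coeffIn α Neg) := fun u => hEneg _ (hN u)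
    have h2 : cc N ∈ coeffIn α (coeffIn α Neg) := const_mem_coeffIn hN
    have h3 : G - 1 = map E N * cc N - map E N - cc N := by
      simp only [hG, map_sub, map_one]
      noncomm_ring
    rw [h3]
    exact sub_mem (sub_mem (mul_mem_coeffIn (mul_mem_coeffIn hneg) _ h1 _ h2) h1) h2
  have hswap_mem {M : AddSubgroup A} {F : WordSeries α (WordSeries α A)}
      (hF : F ∈ coeffIn α (coeffIn α M)) : swap F ∈ coeffIn α (coeffIn α M) :=
    fun u u' => hF u' u
  have hU00 : U [] [] = 1 := by simp [hU, hC0, cc, c]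
  have hG00 : G [] [] = 1 := by simp [hG, hN0, cc]
  -- Uniqueness of the factorization: the difference is negative, its product with `U` is
  -- non-negative, and the constant term of `U` is 1. Cancellation is applied once for each set of
  -- letters.
  have hGG : G = swap G := by
    refine sub_eq_zero.mp (eq_zero_of_mul_mem (N := coeffIn α Neg) (Q := coeffIn α Pos) U
      (eq_zero_of_mul_mem (U []) ?_) _ ?_ ?_)
    · intro a ha ha'
      rw [hU00, mul_one] at ha'
      exact hdisj a ha ha'
    · have h := sub_mem hGneg (hswap_mem hGneg)
      rwa [map_sub, map_one, sub_sub_sub_cancel_right] at h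
    · have h := sub_mem hGpos (hswap_mem hGpos)
      rwa [map_mul, hswapU, ← sub_mul] at h
  -- The dressing relation is used twice: under `E` in the outer letters, then directly in the inner
  -- ones.
  have hFG : map E (E L) * G = G * cc (c L) := by
    have h1 := congrArg (map E) hL
    have h2 := congrArg cc hL
    simp only [map_mul, map_const] at h1 h2
    calc map E (E L) * G = map E (1 - N) * (const (E L) * cc (1 - N)) := by
          rw [hG, ← mul_assoc, h1, mul_assoc]
      _ = _ := by
          rw [show const (E L) = cc (E L) from rfl, h2, hG, mul_assoc]; rfl
  have hFG' : swap (map E (E L)) * G = G * cc (c L) := by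
    have h := congrArg swap hFG
    rw [map_mul swap _ G, ← hGG] at h
    rw [h, map_mul, ← hGG]
    congr 1
    simp only [cc, c, constHom_apply, swap_const, map_const]
  have hF : map E (E L) = swap (map E (E L)) := by
    -- With `⊤` and `⊥` the lemma is plain right cancellation by a series with constant term 1.
    refine sub_eq_zero.mp (eq_zero_of_mul_mem (N := ⊤) (Q := coeffIn α ⊥) G ?_ _
      (fun _ => AddSubgroup.mem_top _) ?_)
    · intro f _ hf
      refine eq_zero_of_mul_mem (N := ⊤) (Q := ⊥) (G []) ?_ f
        (fun _ => AddSubgroup.mem_top _) hf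
      intro a _ ha
      rwa [hG00, mul_one, AddSubgroup.mem_bot] at ha
    · rw [sub_mul, hFG, hFG', sub_self]
      exact zero_mem _
  exact congrArg (fun f => f w v) hF

end WordSeries

/-! ### Positive and negative parts of pseudo-differential operators -/

namespace PsiDO

variable {K A : Type*} [Field K] [Ring A] [Algebra K A] {D : NCDeriv K A}

theorem pos_eq_zero_iff (X : PsiDO D) : pos X = 0 ↔ ∀ i, -1 < i → X.coeff i = 0 := by
  constructor
  · intro h i hi
    have := congrArg (fun Y => Y.coeff i) h
    simpa [show 0 ≤ i by omega] using this
  · intro h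
    ext i
    rw [coeff_pos, coeff_zero]
    split_ifs with hi
    · exact h i (by omega)
    · rfl

theorem neg_eq_zero_iff (X : PsiDO D) : neg X = 0 ↔ ∀ i, i < 0 → X.coeff i = 0 := by
  constructor
  · intro h i hi
    have := congrArg (fun Y => Y.coeff i) h
    simpa [hi] using this
  · intro h
    ext i
    rw [coeff_neg_part, coeff_zero]
    split_ifs with hi
    · exact h i hi
    · rfl

theorem pos_mul_eq_zero {X Y : PsiDO D} (hX : pos X = 0) (hY : pos Y = 0) : pos (X * Y) = 0 := by
  rw [pos_eq_zero_iff] at *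
  exact fun i hi => coeff_mul_eq_zero X Y hX hY i (by omega)

/-- For `i ≥ 0` the binomial coefficient `i` over `k` vanishes when `k > i`, and for `k ≤ i` a
negative total order forces a negative order in `Y`. -/
theorem neg_mul_eq_zero {X Y : PsiDO D} (hX : neg X = 0) (hY : neg Y = 0) : neg (X * Y) = 0 := by
  rw [neg_eq_zero_iff] at *
  intro n hn
  rw [coeff_mul, ← finsum_zero (α := ℤ × ℕ)]
  refine finsum_congr ?_
  rintro ⟨i, k⟩
  dsimp only
  rcases lt_or_ge i 0 with hi | hi
  · rw [hX i hi, zero_mul, smul_zero]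
  · lift i to ℕ using hi
    rcases lt_or_ge i k with hk | hk
    · rw [Ring.choose_natCast, Nat.choose_eq_zero_of_lt hk, Nat.cast_zero, zero_smul]
    · rw [hY _ (by omega), map_zero, mul_zero, smul_zero]

/-- A commutator of a negative operator with a monic operator of order one is negative. -/
theorem pos_lie_eq_zero {X Y : PsiDO D} (hX : pos X = 0) (hY : ∀ i, 1 < i → Y.coeff i = 0)
    (hY1 : Y.coeff 1 = 1) : pos (X * Y - Y * X) = 0 := by
  rw [pos_eq_zero_iff] at *
  intro i hi
  rw [coeff_sub]
  -- Only order 0 needs an argument: there both products have the coefficient of `∂⁻¹` in `X`,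
  -- because the leading coefficient of `Y` is 1.
  rcases (show 0 ≤ i by omega).eq_or_lt with rfl | hi
  · have h1 := coeff_mul_eq X Y hX hY 0
    have h2 := coeff_mul_eq Y X hY hX 0
    simp only [Finset.HasAntidiagonal.antidiagonal_zero, Finset.sum_singleton, Nat.cast_zero, sub_zero,
      Ring.choose_zero_right, one_smul, NCDeriv.iter_zero, hY1, mul_one, one_mul] at h1 h2
    rw [show (-1 + 1 : ℤ) = 0 by norm_num] at h1
    rw [show (1 + -1 : ℤ) = 0 by norm_num] at h2
    rw [h1, h2, sub_self]
  · rw [coeff_mul_eq_zero X Y hX hY i (by omega), coeff_mul_eq_zero Y X hY hX i (by omega),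
      sub_zero]

end PsiDO

namespace KP

variable (K : Type*) [Field K]

/-! ### The algebra `R` -/

/-- `∂⁻¹` as an element of `R`. -/
noncomputable def delInvR : algR K := ⟨PsiDO.delInv, delInv_mem K⟩

variable {K}

/-- Induction along the generation of `R` by `L` and `∂⁻¹`. -/
theorem algR_induction {p : algR K → Prop} (one : p 1) (lax : p (L K)) (delInv : p (delInvR K))
    (add : ∀ X Y, p X → p Y → p (X + Y)) (smul : ∀ (c : K) X, p X → p (c • X))
    (mul : ∀ X Y, p X → p Y → p (X * Y)) (pos : ∀ X, p X → p (posR K X)) (X : algR K) : p X := by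
  let S : Subalgebra K (Psi K) :=
    { carrier := {X | ∃ h : X ∈ algR K, p ⟨X, h⟩}
      mul_mem' := fun ⟨ha, pa⟩ ⟨hb, pb⟩ => ⟨mul_mem ha hb, mul _ _ pa pb⟩
      add_mem' := fun ⟨ha, pa⟩ ⟨hb, pb⟩ => ⟨add_mem ha hb, add _ _ pa pb⟩
      algebraMap_mem' := fun c => by
        refine ⟨(algR K).algebraMap_mem c, ?_⟩
        have h := smul c 1 one
        rwa [← Algebra.algebraMap_eq_smul_one] at h }
  have hS : algR K ≤ S :=
    sInf_le ⟨⟨laxOp_mem K, lax⟩, ⟨delInv_mem K, delInv⟩, fun X ⟨h, hp⟩ => ⟨pos_mem K h, pos _ hp⟩⟩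
  exact (hS X.2).2

theorem posR_eq_zero {X : algR K} : posR K X = 0 ↔ PsiDO.pos X.1 = 0 := Subtype.ext_iff

theorem negR_eq_zero {X : algR K} : negR K X = 0 ↔ PsiDO.neg X.1 = 0 := Subtype.ext_iff

theorem negR_eq_sub (X : algR K) : negR K X = X - posR K X :=
  eq_sub_of_add_eq' (posR_add_negR K X)

theorem posR_posR (X : algR K) : posR K (posR K X) = posR K X := by
  apply Subtype.ext
  change PsiDO.pos (PsiDO.pos X.1) = PsiDO.pos X.1
  ext i
  rw [PsiDO.coeff_pos, PsiDO.coeff_pos]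
  split_ifs <;> rfl

theorem posR_negR (X : algR K) : posR K (negR K X) = 0 := by
  rw [negR_eq_sub, map_sub, posR_posR, sub_self]

theorem negR_posR (X : algR K) : negR K (posR K X) = 0 := by
  rw [negR_eq_sub, posR_posR, sub_self]

theorem negR_one : negR K 1 = 0 := by
  rw [negR_eq_zero, PsiDO.neg_eq_zero_iff]
  intro i hi
  change (1 : Psi K).coeff i = 0
  rw [PsiDO.one_def, PsiDO.coeff_monomial, if_neg (by omega)]

theorem laxOp_coeff_of_one_lt (i : ℤ) (hi : 1 < i) : (laxOp K).coeff i = 0 := by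
  rw [laxOp, PsiDO.coeff_mk, if_neg (by omega), if_neg (by omega)]

theorem laxOp_coeff_one : (laxOp K).coeff 1 = 1 := by
  rw [laxOp, PsiDO.coeff_mk, if_pos rfl]

theorem posR_lie_L {X : algR K} (hX : posR K X = 0) : posR K ⁅X, L K⁆ = 0 := by
  rw [posR_eq_zero] at *
  exact PsiDO.pos_lie_eq_zero hX laxOp_coeff_of_one_lt laxOp_coeff_one

theorem posR_mul_eq_zero {X Y : algR K} (hX : posR K X = 0) (hY : posR K Y = 0) :
    posR K (X * Y) = 0 := by
  rw [posR_eq_zero] at *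
  exact PsiDO.pos_mul_eq_zero hX hY

theorem negR_mul_eq_zero {X Y : algR K} (hX : negR K X = 0) (hY : negR K Y = 0) :
    negR K (X * Y) = 0 := by
  rw [negR_eq_zero] at *
  exact PsiDO.neg_mul_eq_zero hX hY

theorem posR_L_coe : (posR K (L K) : Psi K) = PsiDO.del := by
  change PsiDO.pos (laxOp K) = PsiDO.del
  ext i
  rw [PsiDO.coeff_pos, laxOp, PsiDO.coeff_mk, PsiDO.del, PsiDO.coeff_monomial]
  split_ifs <;> first | rfl | omega

theorem posR_L_mul_delInvR : posR K (L K) * delInvR K = 1 := by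
  apply Subtype.ext
  change (posR K (L K) : Psi K) * PsiDO.delInv = 1
  rw [posR_L_coe, PsiDO.del_mul_delInv]

theorem delInvR_mul_posR_L : delInvR K * posR K (L K) = 1 := by
  apply Subtype.ext
  change PsiDO.delInv * (posR K (L K) : Psi K) = 1
  rw [posR_L_coe, PsiDO.delInv_mul_del]

/-! ### The elements `L^{m₁, …, mₖ}` -/

theorem ell_powP (n : ℕ) : ell K (AP.powP K n) = L K ^ (n + 1) := by
  induction n with
  | zero => rw [AP.powP, ell_P, zero_add, pow_one]
  | succ n ih => rw [AP.powP, ell_bullet_P, ih, pow_succ _ (n + 1)]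

/-- By associativity the power of `P` is appended one `•`-factor at a time, so the projection acts
only at the single `≺`. -/
theorem ell_prec_powP (α : AP K) (n : ℕ) :
    ell K (AP.prec α (AP.powP K n)) = -(negR K (ell K α) * L K ^ (n + 1)) := by
  induction n with
  | zero => rw [AP.powP, ell_prec_P, zero_add, pow_one]
  | succ n ih =>
    have h : AP.prec α (AP.powP K (n + 1)) = AP.bullet (AP.prec α (AP.powP K n)) (AP.P K) :=
      (AP.mulOp_assoc K _ _ _ _ _).symm
    rw [h, ell_bullet_P, ih, pow_succ _ (n + 1), neg_mul, mul_assoc]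

/-- `AP.Pw` is built from the left while ℓ recurses from the right; associativity of `≺` reconciles
the two. -/
theorem Pw_append (m : ℕ+) (w : List ℕ+) (n : ℕ+) :
    AP.Pw K m (w ++ [n]) = AP.prec (AP.Pw K m w) (AP.powP K n.natPred) := by
  induction w generalizing m with
  | nil => rfl
  | cons k w ih =>
    rw [List.cons_append, AP.Pw, ih, AP.Pw]
    exact (AP.mulOp_assoc K _ _ _ _ _).symm

theorem Lw_singleton (n : ℕ+) : Lw K [n] = L K ^ (n : ℕ) := by
  rw [Lw, AP.Pw, ell_powP, PNat.natPred_add_one]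

theorem Lw_append {w : List ℕ+} (hw : w ≠ []) (n : ℕ+) :
    Lw K (w ++ [n]) = -(negR K (Lw K w) * L K ^ (n : ℕ)) := by
  cases w with
  | nil => exact absurd rfl hw
  | cons m w => rw [List.cons_append, Lw, Pw_append, ell_prec_powP, PNat.natPred_add_one, Lw]

/-! ### Generating series -/

variable (K)

/-- The series `∑ (L^w)_{<0} w`. -/
noncomputable def negSeries : WordSeries ℕ+ (algR K) := ⟨fun w => negR K (Lw K w)⟩

/-- The series `∑ (L^w)_{≥0} w`. -/
noncomputable def posSeries : WordSeries ℕ+ (algR K) := ⟨fun w => posR K (Lw K w)⟩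

/-- The series `∑ Lⁿ n` with nonzero coefficients at one-letter words only. -/
noncomputable def powSeries : WordSeries ℕ+ (algR K) where
  coeff
    | [n] => L K ^ (n : ℕ)
    | _ => 0

variable {K}

theorem powSeries_nil : powSeries K [] = 0 := rfl

theorem powSeries_apply (w : List ℕ+) :
    powSeries K w = 0 ∨ ∃ n : ℕ, powSeries K w = L K ^ n :=
  match w with
  | [] => .inl rfl
  | [n] => .inr ⟨n, rfl⟩
  | _ :: _ :: _ => .inl rfl

theorem powSeries_of_length {w : List ℕ+} (hw : w.length ≠ 1) : powSeries K w = 0 :=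
  match w with
  | [] => rfl
  | [_] => absurd rfl hw
  | _ :: _ :: _ => rfl

theorem mul_powSeries_append (f : WordSeries ℕ+ (algR K)) (w : List ℕ+) (n : ℕ+) :
    (f * powSeries K) (w ++ [n]) = f w * L K ^ (n : ℕ) := by
  rw [WordSeries.mul_apply, Finset.sum_eq_single w.length]
  · rw [List.take_left, List.drop_left]
    rfl
  · intro j hj hj'
    rw [powSeries_of_length, mul_zero]
    rw [List.length_drop, List.length_append, List.length_singleton]
    omega
  · intro h
    exact absurd (Finset.mem_range.mpr (by simp)) h

theorem one_apply_of_ne {w : List ℕ+} (hw : w ≠ []) : (1 : WordSeries ℕ+ (algR K)) w = 0 :=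
  WordSeries.const_of_ne 1 hw

theorem negSeries_nil : negSeries K [] = 0 := map_zero _

/-- The factorization of `1 + ∑ Lⁿ n`. -/
theorem factorization : (1 - negSeries K) * (1 + powSeries K) = 1 + posSeries K := by
  -- This is the recursion `Lw_append` in series form; the unit accounts for the one-letter words.
  have h : ((1 - negSeries K) * powSeries K) = ⟨Lw K⟩ := by
    refine WordSeries.ext_apply fun w => ?_
    induction w using List.reverseRecOn with
    | nil => simp [powSeries_nil, Lw]
    | append_singleton w n =>
      rw [mul_powSeries_append, WordSeries.sub_apply]
      rcases eq_or_ne w [] with rfl | hw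
      · rw [negSeries_nil, sub_zero, WordSeries.one_nil, one_mul]
        exact (Lw_singleton n).symm
      · rw [one_apply_of_ne hw, zero_sub, neg_mul]
        exact (Lw_append hw n).symm
  rw [mul_add, mul_one, h]
  refine WordSeries.ext_apply fun w => ?_
  simp only [WordSeries.add_apply, WordSeries.sub_apply, negSeries, posSeries, negR_eq_sub]
  abel

/-- A series is the conjugate of `L` by `1 - ∑ (L^w)_{<0} w` as soon as its coefficients satisfy
the recursion of the generalized Lax equations. -/
theorem mul_one_sub_negSeries {T : WordSeries ℕ+ (algR K)} (h0 : T [] = L K)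
    (h : ∀ w, w ≠ [] → T w = -⁅negR K (Lw K w), L K⁆ +
      ∑ j ∈ Finset.Ico 1 w.length, T (w.take j) * negR K (Lw K (w.drop j))) :
    T * (1 - negSeries K) = (1 - negSeries K) * WordSeries.const (L K) := by
  refine WordSeries.ext_apply fun w => ?_
  rcases eq_or_ne w [] with rfl | hw
  · simp [h0, negSeries_nil]
  have hsum : ∑ j ∈ Finset.range w.length, T (w.take j) * (1 - negSeries K) (w.drop j) =
      -∑ j ∈ Finset.range w.length, T (w.take j) * negR K (Lw K (w.drop j)) := by
    rw [← Finset.sum_neg_distrib]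
    refine Finset.sum_congr rfl fun j hj => ?_
    have hne : w.drop j ≠ [] := by
      simpa [List.drop_eq_nil_iff] using hj
    rw [WordSeries.sub_apply, one_apply_of_ne hne, zero_sub, mul_neg]
    rfl
  -- The last split yields `T w`; the split `j = 0` yields the product of `L` with the negative
  -- part, the missing half of the commutator.
  rw [WordSeries.mul_apply_last, WordSeries.mul_const_apply, hsum, Finset.range_eq_Ico,
    Finset.sum_eq_sum_Ico_succ_bot (List.length_pos_of_ne_nil hw), List.take_zero, h0,
    List.drop_zero, WordSeries.sub_apply, WordSeries.sub_apply, one_apply_of_ne hw,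
    WordSeries.one_nil, negSeries_nil, h w hw, Ring.lie_def]
  change _ = (0 - negR K (Lw K w)) * L K
  noncomm_ring

/-- The generalized Lax equations in terms of the non-negative parts. -/
theorem lax_eq_pos {T : WordSeries ℕ+ (algR K)} (h0 : T [] = L K)
    (h : T * (1 - negSeries K) = (1 - negSeries K) * WordSeries.const (L K)) {w : List ℕ+}
    (hw : w ≠ []) : T w = ⁅posR K (Lw K w), L K⁆ -
      ∑ j ∈ Finset.Ico 1 w.length, T (w.take j) * posR K (Lw K (w.drop j)) := by
  have hpow : WordSeries.const (L K) * (1 + powSeries K) =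
      (1 + powSeries K) * WordSeries.const (L K) := by
    refine WordSeries.ext_apply fun u => ?_
    rw [WordSeries.const_mul_apply, WordSeries.mul_const_apply, WordSeries.add_apply]
    rcases eq_or_ne u [] with rfl | hu
    · simp [powSeries_nil]
    · rw [one_apply_of_ne hu, zero_add]
      rcases powSeries_apply (K := K) u with h | ⟨n, h⟩
      · rw [h, mul_zero, zero_mul]
      · rw [h, ← pow_succ, ← pow_succ']
  have hT : T * (1 + posSeries K) = (1 + posSeries K) * WordSeries.const (L K) := by
    rw [← factorization, ← mul_assoc, h, mul_assoc, hpow, mul_assoc]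
  have hw' := congrArg (fun f => f w) hT
  have hsum : ∑ j ∈ Finset.range w.length, T (w.take j) * (1 + posSeries K) (w.drop j) =
      ∑ j ∈ Finset.range w.length, T (w.take j) * posR K (Lw K (w.drop j)) := by
    refine Finset.sum_congr rfl fun j hj => ?_
    have hne : w.drop j ≠ [] := by
      simpa [List.drop_eq_nil_iff] using hj
    rw [WordSeries.add_apply, one_apply_of_ne hne, zero_add]
    rfl
  have hnil : posSeries K [] = 0 := map_zero _
  rw [WordSeries.mul_apply_last, WordSeries.mul_const_apply, hsum, Finset.range_eq_Ico,
    Finset.sum_eq_sum_Ico_succ_bot (List.length_pos_of_ne_nil hw), List.take_zero, h0,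
    List.drop_zero, WordSeries.add_apply, WordSeries.add_apply, one_apply_of_ne hw,
    WordSeries.one_nil, hnil, zero_add, zero_add, add_zero, mul_one] at hw'
  rw [Ring.lie_def, eq_sub_iff_add_eq, eq_sub_iff_add_eq']
  change _ = posSeries K w * L K
  rw [← hw']
  abel

/-! ### Consequences of the rules for generalized derivations -/

namespace IsGenDer

variable {δ : List ℕ+ → Module.End K (algR K)}

theorem apply_nil (h : IsGenDer K δ) (X : algR K) : δ [] X = X := by
  rw [h.nil, Module.End.one_apply]

/-- The image of 1 is an idempotent series with constant term 1; it is right cancellable, so it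
equals 1. -/
theorem map_one_series (h : IsGenDer K δ) :
    (⟨fun w => δ w 1⟩ : WordSeries ℕ+ (algR K)) = 1 := by
  set e : WordSeries ℕ+ (algR K) := ⟨fun w => δ w 1⟩ with he
  have hmul : e * e = e := by
    refine WordSeries.ext_apply fun w => ?_
    have := h.mul w 1 1
    rw [mul_one] at this
    exact this.symm
  have h0 : e [] = 1 := h.apply_nil 1
  refine sub_eq_zero.mp (WordSeries.eq_zero_of_mul_mem (N := ⊤) (Q := ⊥) e ?_ _
    (fun _ => AddSubgroup.mem_top _) ?_)
  · intro a _ ha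
    rwa [h0, mul_one, AddSubgroup.mem_bot] at ha
  · rw [sub_mul, hmul, one_mul, sub_self]
    exact zero_mem _

/-- The generating series of the generalized derivations, as a ring homomorphism. -/
noncomputable def toHom (h : IsGenDer K δ) : algR K →+* WordSeries ℕ+ (algR K) where
  toFun X := ⟨fun w => δ w X⟩
  map_one' := h.map_one_series
  map_zero' := WordSeries.ext_apply fun w => map_zero (δ w)
  map_add' X Y := WordSeries.ext_apply fun w => map_add (δ w) X Y
  map_mul' X Y := WordSeries.ext_apply fun w => h.mul w X Y

theorem toHom_apply (h : IsGenDer K δ) (X : algR K) (w : List ℕ+) : h.toHom X w = δ w X := rfl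

theorem negR_comm (h : IsGenDer K δ) (w : List ℕ+) (X : algR K) :
    δ w (negR K X) = negR K (δ w X) := by
  rw [negR_eq_sub, map_sub, h.proj, negR_eq_sub]

theorem toHom_L_mul (h : IsGenDer K δ) :
    h.toHom (L K) * (1 - negSeries K) = (1 - negSeries K) * WordSeries.const (L K) :=
  mul_one_sub_negSeries (h.apply_nil _) h.lax

/-- Induction on the length: the commutator of a negative operator with L is negative, and so are
products of negative operators. This is why the family annihilates ∂. -/
theorem posR_lax (h : IsGenDer K δ) {w : List ℕ+} (hw : w ≠ []) : posR K (δ w (L K)) = 0 := by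
  induction hn : w.length using Nat.strong_induction_on generalizing w with
  | _ n ih =>
    subst hn
    rw [h.lax w hw, map_add, map_neg, posR_lie_L (posR_negR _), neg_zero, zero_add, map_sum]
    refine Finset.sum_eq_zero fun j hj => ?_
    rw [Finset.mem_Ico] at hj
    refine posR_mul_eq_zero (ih (w.take j).length ?_ ?_ rfl) (posR_negR _)
    · rw [List.length_take]
      omega
    · rw [Ne, List.take_eq_nil_iff]
      rintro (h | h)
      exacts [by omega, hw h]

/-- The series homomorphism fixes ∂ = L_{≥0}, hence also its inverse. -/
theorem toHom_delInv (h : IsGenDer K δ) :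
    h.toHom (delInvR K) = WordSeries.const (delInvR K) := by
  have hdel : h.toHom (posR K (L K)) = WordSeries.const (posR K (L K)) := by
    refine WordSeries.ext_apply fun w => ?_
    rw [h.toHom_apply]
    rcases eq_or_ne w [] with rfl | hw
    · exact h.apply_nil _
    · rw [h.proj, h.posR_lax hw, WordSeries.const_of_ne _ hw]
  have h1 : h.toHom (delInvR K) * WordSeries.const (posR K (L K)) = 1 := by
    rw [← hdel, ← map_mul, delInvR_mul_posR_L, map_one]
  have h2 : (WordSeries.const (posR K (L K)) : WordSeries ℕ+ (algR K)) *
      WordSeries.const (delInvR K) = 1 := by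
    simp only [← WordSeries.constHom_apply]
    rw [← map_mul, posR_L_mul_delInvR, map_one]
  exact left_inv_eq_right_inv h1 h2

/-- The dressing argument applies with the kernels of the two projections as negative and positive
parts; both are stable because the operators commute with the projections. -/
theorem comm_L (h : IsGenDer K δ) (v w : List ℕ+) :
    δ v (δ w (L K)) = δ w (δ v (L K)) := by
  refine WordSeries.coeff_comm_of_dressing h.toHom
    (Neg := (posR K).toAddMonoidHom.ker) (Pos := (negR K).toAddMonoidHom.ker)
    (N := negSeries K) (P := posSeries K) (C := powSeries K)
    ?_ (fun _ ha _ hb => posR_mul_eq_zero ha hb) (fun _ ha _ hb => negR_mul_eq_zero ha hb)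
    negR_one ?_ ?_ (fun w => posR_negR _) (fun w => negR_posR _) negSeries_nil powSeries_nil
    powSeries_apply h.toHom_L_mul factorization v w
  · intro a ha hb
    rw [← posR_add_negR K a, show posR K a = 0 from ha, show negR K a = 0 from hb, add_zero]
  · intro a ha w
    change posR K (δ w a) = 0
    rw [← h.proj, show posR K a = 0 from ha, map_zero]
  · intro a ha w
    change negR K (δ w a) = 0
    rw [← h.negR_comm, show negR K a = 0 from ha, map_zero]

/-- The generalized derivations commute. -/
theorem comm (h : IsGenDer K δ) (v w : List ℕ+) (X : algR K) :
    δ v (δ w X) = δ w (δ v X) := by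
  -- The compositions in the two orders are the coefficients of `F` and of its exchange, both ring
  -- homomorphisms, so a check on generators suffices.
  let F : algR K →+* WordSeries ℕ+ (WordSeries ℕ+ (algR K)) :=
    (WordSeries.map h.toHom).comp h.toHom
  suffices hF : F X = WordSeries.swap (F X) from congrArg (fun f => f w v) hF
  induction X using algR_induction with
  | one => rw [map_one, map_one]
  | lax =>
    exact WordSeries.ext_apply fun w => WordSeries.ext_apply fun v => h.comm_L v w
  | delInv =>
    change WordSeries.map h.toHom (h.toHom (delInvR K)) =
      WordSeries.swap (WordSeries.map h.toHom (h.toHom (delInvR K)))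
    rw [h.toHom_delInv, WordSeries.map_const, h.toHom_delInv, WordSeries.swap_const,
      WordSeries.map_const, WordSeries.constHom_apply]
  | add X Y hX hY => rw [map_add, map_add, ← hX, ← hY]
  | mul X Y hX hY => rw [map_mul, map_mul, ← hX, ← hY]
  | smul c X hX =>
    refine WordSeries.ext_apply fun w => WordSeries.ext_apply fun v => ?_
    have := congrArg (fun f => f w v) hX
    change δ v (δ w X) = δ w (δ v X) at this
    change δ v (δ w (c • X)) = δ w (δ v (c • X))
    simp only [map_smul, this]
  | pos X hX =>
    refine WordSeries.ext_apply fun w => WordSeries.ext_apply fun v => ?_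
    have := congrArg (fun f => f w v) hX
    change δ v (δ w X) = δ w (δ v X) at this
    change δ v (δ w (posR K X)) = δ w (δ v (posR K X))
    simp only [h.proj, this]

/-- The rules determine the generalized derivations. -/
theorem unique {δ' : List ℕ+ → Module.End K (algR K)} (h : IsGenDer K δ) (h' : IsGenDer K δ') :
    δ = δ' := by
  -- The recursion for a word involves only the values on L at its proper nonempty prefixes.
  have hL (n : ℕ) : ∀ w : List ℕ+, w.length = n → δ w (L K) = δ' w (L K) := by
    induction n using Nat.strong_induction_on with
    | _ n ih =>
      rintro w rfl
      rcases eq_or_ne w [] with rfl | hw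
      · rw [h.nil, h'.nil]
      rw [h.lax w hw, h'.lax w hw]
      congr 1
      refine Finset.sum_congr rfl fun j hj => ?_
      rw [Finset.mem_Ico] at hj
      rw [ih (w.take j).length (by rw [List.length_take]; omega) _ rfl]
  suffices hX : ∀ X, h.toHom X = h'.toHom X from
    funext fun w => LinearMap.ext fun X => congrArg (fun f => f w) (hX X)
  intro X
  induction X using algR_induction with
  | one => rw [map_one, map_one]
  | lax => exact WordSeries.ext_apply fun w => hL _ w rfl
  | delInv => rw [h.toHom_delInv, h'.toHom_delInv]
  | add X Y hX hY => rw [map_add, map_add, hX, hY]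
  | mul X Y hX hY => rw [map_mul, map_mul, hX, hY]
  | smul c X hX =>
    refine WordSeries.ext_apply fun w => ?_
    have := congrArg (fun f => f w) hX
    change δ w X = δ' w X at this
    change δ w (c • X) = δ' w (c • X)
    simp only [map_smul, this]
  | pos X hX =>
    refine WordSeries.ext_apply fun w => ?_
    have := congrArg (fun f => f w) hX
    change δ w X = δ' w X at this
    change δ w (posR K X) = δ' w (posR K X)
    rw [h.proj, h'.proj, this]

end IsGenDer

end KP

/-! ### Construction of the generalized derivations -/

namespace WordSeries

variable {α K A : Type*} [Field K] [Ring A] [Algebra K A]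

noncomputable instance : Algebra K (WordSeries α A) :=
  ((constHom α A).comp (algebraMap K A)).toAlgebra' fun c f => ext_apply fun w => by
    simp [Algebra.commutes]

theorem algebraMap_eq (c : K) :
    algebraMap K (WordSeries α A) c = const (algebraMap K A c) := rfl

theorem smul_apply (c : K) (f : WordSeries α A) (w : List α) : (c • f) w = c • f w := by
  rw [Algebra.smul_def, algebraMap_eq, const_mul_apply, Algebra.smul_def]

end WordSeries

namespace NCDeriv

variable {K A : Type*} [Field K] [Ring A] [Algebra K A] (D : NCDeriv K A)

theorem toLin_algebraMap (c : K) : D.toLin (algebraMap K A c) = 0 := by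
  rw [Algebra.algebraMap_eq_smul_one, map_smul, toLin_one, smul_zero]

theorem iter_succ (k : ℕ) (a : A) : D.iter (k + 1) a = D.toLin (D.iter k a) := by
  simp [iter, pow_succ']

end NCDeriv

/-- A homomorphism into series all of whose coefficients commute with the derivation `D` acts
coefficientwise on pseudo-differential operators. -/
structure DerivHom {K A : Type*} [Field K] [Ring A] [Algebra K A] (α : Type*)
    (D : NCDeriv K A) where
  toHom : A →ₐ[K] WordSeries α A
  toHom_nil : ∀ a, toHom a [] = a
  comm : ∀ a w, toHom (D.toLin a) w = D.toLin (toHom a w)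

namespace DerivHom

variable {K A : Type*} [Field K] [Ring A] [Algebra K A] {α : Type*} {D : NCDeriv K A}
  (d : DerivHom α D)

theorem comm_iter (k : ℕ) (a : A) (w : List α) :
    d.toHom (D.iter k a) w = D.iter k (d.toHom a w) := by
  induction k with
  | zero => rw [NCDeriv.iter_zero, NCDeriv.iter_zero]
  | succ k ih => rw [NCDeriv.iter_succ, d.comm, ih, NCDeriv.iter_succ]

/-- The coefficient at the word `w`. -/
noncomputable def coeff (w : List α) : A →ₗ[K] A where
  toFun a := d.toHom a w
  map_add' a b := by rw [map_add, WordSeries.add_apply]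
  map_smul' c a := by rw [map_smul, WordSeries.smul_apply, RingHom.id_apply]

theorem coeff_apply (w : List α) (a : A) : d.coeff w a = d.toHom a w := rfl

theorem coeff_mul (w : List α) (a b : A) : d.coeff w (a * b) =
    ∑ j ∈ Finset.range (w.length + 1), d.coeff (w.take j) a * d.coeff (w.drop j) b := by
  rw [coeff_apply, map_mul, WordSeries.mul_apply]
  rfl

/-- The coefficientwise action on pseudo-differential operators. -/
noncomputable def onPsi (w : List α) : PsiDO D →ₗ[K] PsiDO D where
  toFun X := PsiDO.mk (fun i => d.coeff w (X.coeff i)) (by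
    obtain ⟨N, hN⟩ := X.bdd
    exact ⟨N, fun i hi => by rw [hN i hi, map_zero]⟩)
  map_add' X Y := by
    ext i
    simp
  map_smul' c X := by
    ext i
    simp

@[simp] theorem coeff_onPsi (w : List α) (X : PsiDO D) (i : ℤ) :
    (d.onPsi w X).coeff i = d.coeff w (X.coeff i) := rfl

theorem onPsi_nil (X : PsiDO D) : d.onPsi [] X = X := by
  ext i
  exact d.toHom_nil _

theorem onPsi_pos (w : List α) (X : PsiDO D) :
    d.onPsi w (PsiDO.pos X) = PsiDO.pos (d.onPsi w X) := by
  ext i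
  simp only [coeff_onPsi, PsiDO.coeff_pos]
  split_ifs
  exacts [rfl, map_zero _]

/-- Coefficients of a product are integer combinations of `a * D.iter k b`. The coefficient maps
satisfy the generalized Leibniz rule and commute with `D`, so the rule carries over. -/
theorem onPsi_mul (w : List α) (X Y : PsiDO D) : d.onPsi w (X * Y) =
    ∑ j ∈ Finset.range (w.length + 1), d.onPsi (w.take j) X * d.onPsi (w.drop j) Y := by
  have hsum (s : Finset ℕ) (F : ℕ → PsiDO D) (i : ℤ) :
      (∑ j ∈ s, F j).coeff i = ∑ j ∈ s, (F j).coeff i := by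
    induction s using Finset.induction_on with
    | empty => simp
    | insert a s ha ih => rw [Finset.sum_insert ha, Finset.sum_insert ha, PsiDO.coeff_add, ih]
  obtain ⟨N, hN⟩ := X.bdd
  obtain ⟨M, hM⟩ := Y.bdd
  -- One order bound serves all words, so every product expands over the same finite index set.
  have hN' (v : List α) (i : ℤ) (hi : N < i) : (d.onPsi v X).coeff i = 0 := by
    rw [coeff_onPsi, hN i hi, map_zero]
  have hM' (v : List α) (i : ℤ) (hi : M < i) : (d.onPsi v Y).coeff i = 0 := by
    rw [coeff_onPsi, hM i hi, map_zero]
  ext n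
  rw [coeff_onPsi, hsum]
  by_cases hn : N + M < n
  · rw [PsiDO.coeff_mul_eq_zero X Y hN hM n hn, map_zero]
    exact (Finset.sum_eq_zero fun j _ =>
      PsiDO.coeff_mul_eq_zero _ _ (hN' _) (hM' _) n hn).symm
  · obtain ⟨s, rfl⟩ : ∃ s : ℕ, n = N + M - s := ⟨(N + M - n).toNat, by omega⟩
    rw [PsiDO.coeff_mul_eq X Y hN hM]
    simp only [PsiDO.coeff_mul_eq _ _ (hN' _) (hM' _), map_sum, map_zsmul, coeff_mul,
      coeff_onPsi]
    simp only [coeff_apply, comm_iter]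
    rw [Finset.sum_comm]
    refine Finset.sum_congr rfl fun p _ => ?_
    rw [Finset.sum_comm]
    refine Finset.sum_congr rfl fun q _ => ?_
    rw [Finset.smul_sum]

theorem onPsi_monomial_one {w : List α} (hw : w ≠ []) (i : ℤ) :
    d.onPsi w (PsiDO.monomial i 1) = 0 := by
  ext j
  rw [coeff_onPsi, PsiDO.coeff_monomial, PsiDO.coeff_zero]
  split_ifs
  · rw [coeff_apply, map_one]
    exact WordSeries.const_of_ne _ hw
  · exact map_zero _

end DerivHom

/-! ### Extension from the free generators -/

namespace DiffPoly

variable {K : Type*} [Field K] {α : Type*}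

/-- Prescribed images of the symbols `u_{n+2}`, which reduce to `u_{n+2}` at the empty word,
extend to all differential polynomials. -/
noncomputable def derivHom (t : ℕ → WordSeries α (DiffPoly K))
    (ht : ∀ n, t n [] = FreeAlgebra.ι K (n, 0)) : DerivHom α (dx K) :=
  let φ : DiffPoly K →ₐ[K] WordSeries α (DiffPoly K) :=
    -- The images of the derivatives of a symbol are forced by commutation with ∂_x.
    FreeAlgebra.lift K fun p => ⟨fun w => (dx K).iter p.2 (t p.1 w)⟩
  have hφ (p : ℕ × ℕ) (w : List α) : φ (FreeAlgebra.ι K p) w = (dx K).iter p.2 (t p.1 w) := by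
    rw [FreeAlgebra.lift_ι_apply, WordSeries.mk_apply]
  { toHom := φ
    toHom_nil := fun a => by
      induction a using FreeAlgebra.induction with
      | grade0 c => rw [AlgHom.commutes]; rfl
      | grade1 p =>
        obtain ⟨n, j⟩ := p
        rw [hφ, ht]
        dsimp only
        induction j with
        | zero => rw [NCDeriv.iter_zero]
        | succ j ih => rw [NCDeriv.iter_succ, ih, dx_ι]
      | mul a b ha hb => rw [map_mul, WordSeries.mul_nil, ha, hb]
      | add a b ha hb => rw [map_add, WordSeries.add_apply, ha, hb]
    comm := fun a => by
      induction a using FreeAlgebra.induction with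
      | grade0 c =>
        rintro (_ | ⟨x, w⟩)
        · rw [NCDeriv.toLin_algebraMap, map_zero, AlgHom.commutes]
          exact (NCDeriv.toLin_algebraMap _ c).symm
        · rw [NCDeriv.toLin_algebraMap, map_zero, AlgHom.commutes]
          exact (map_zero _).symm
      | grade1 p =>
        intro w
        rw [dx_ι, hφ, hφ, NCDeriv.iter_succ]
      | mul a b ha hb =>
        intro w
        rw [NCDeriv.leibniz, map_add, map_mul, map_mul, map_mul, WordSeries.add_apply,
          WordSeries.mul_apply, WordSeries.mul_apply, WordSeries.mul_apply, map_sum,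
          ← Finset.sum_add_distrib]
        exact Finset.sum_congr rfl fun j _ => by rw [ha, hb, NCDeriv.leibniz]
      | add a b ha hb =>
        intro w
        rw [map_add, map_add, map_add, WordSeries.add_apply, WordSeries.add_apply, ha, hb,
          map_add] }

theorem derivHom_ι (t : ℕ → WordSeries α (DiffPoly K))
    (ht : ∀ n, t n [] = FreeAlgebra.ι K (n, 0)) (n : ℕ) (w : List α) :
    (derivHom t ht).toHom (FreeAlgebra.ι K (n, 0)) w = t n w := by
  change FreeAlgebra.lift K (fun p : ℕ × ℕ =>
    (⟨fun w => (dx K).iter p.2 (t p.1 w)⟩ : WordSeries α (DiffPoly K)))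
      (FreeAlgebra.ι K (n, 0)) w = t n w
  rw [FreeAlgebra.lift_ι_apply, WordSeries.mk_apply, NCDeriv.iter_zero]

end DiffPoly

/-! ### Solving the recursion and restricting the action to R -/

namespace KP

variable (K : Type*) [Field K]

/-- The solution of the recursion which determines `δ_w L`. -/
noncomputable def laxFlow (w : List ℕ+) : algR K :=
  if w = [] then L K else -⁅negR K (Lw K w), L K⁆ +
    ∑ j ∈ (Finset.Ico 1 w.length).attach, laxFlow (w.take j.1) * negR K (Lw K (w.drop j.1))
termination_by w.length
decreasing_by
  have := Finset.mem_Ico.mp j.2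
  rw [List.length_take]
  omega

theorem laxFlow_nil : laxFlow K [] = L K := by
  rw [laxFlow, if_pos rfl]

theorem laxFlow_of_ne {w : List ℕ+} (hw : w ≠ []) :
    laxFlow K w = -⁅negR K (Lw K w), L K⁆ +
      ∑ j ∈ Finset.Ico 1 w.length, laxFlow K (w.take j) * negR K (Lw K (w.drop j)) := by
  rw [laxFlow, if_neg hw]
  congr 1
  exact Finset.sum_attach _ fun j => laxFlow K (w.take j) * negR K (Lw K (w.drop j))

theorem posR_laxFlow {w : List ℕ+} (hw : w ≠ []) : posR K (laxFlow K w) = 0 := by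
  induction hn : w.length using Nat.strong_induction_on generalizing w with
  | _ n ih =>
    subst hn
    rw [laxFlow_of_ne K hw, map_add, map_neg, posR_lie_L (posR_negR _), neg_zero, zero_add,
      map_sum]
    refine Finset.sum_eq_zero fun j hj => ?_
    rw [Finset.mem_Ico] at hj
    refine posR_mul_eq_zero (ih (w.take j).length ?_ ?_ rfl) (posR_negR _)
    · rw [List.length_take]
      omega
    · rw [Ne, List.take_eq_nil_iff]
      rintro (h | h)
      exacts [by omega, hw h]

/-- The homomorphism which sends the coefficients of `L` to those of the solution. -/
noncomputable def flowHom : DerivHom ℕ+ (DiffPoly.dx K) :=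
  -- The index `n` stands for u_{n+2}, the coefficient of ∂^{-(n+1)} in L.
  DiffPoly.derivHom (fun n => ⟨fun w => (laxFlow K w).1.coeff (-(n : ℤ) - 1)⟩) fun n => by
    rw [WordSeries.mk_apply, laxFlow_nil]
    change (laxOp K).coeff _ = _
    rw [laxOp, PsiDO.coeff_mk, if_neg (by omega), if_pos (by omega)]
    congr 2
    omega

/-- Negative orders agree by the choice of the images of the symbols. In the other orders L has only
constants, killed by nonempty words, and `laxFlow` vanishes there by `posR_laxFlow`. -/
theorem flowHom_onPsi_laxOp (w : List ℕ+) :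
    (flowHom K).onPsi w (laxOp K) = (laxFlow K w : Psi K) := by
  rcases eq_or_ne w [] with rfl | hw
  · rw [DerivHom.onPsi_nil, laxFlow_nil]
    rfl
  ext i
  have hpos := (PsiDO.pos_eq_zero_iff _).mp (posR_eq_zero.mp (posR_laxFlow K hw))
  rw [DerivHom.coeff_onPsi, DerivHom.coeff_apply]
  rcases lt_or_ge i 0 with hi | hi
  · rw [laxOp, PsiDO.coeff_mk, if_neg (by omega), if_pos hi, flowHom, DiffPoly.derivHom_ι,
      WordSeries.mk_apply]
    congr 1
    omega
  · rw [hpos i (by omega), laxOp, PsiDO.coeff_mk]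
    split_ifs with h1 h2
    · rw [map_one]
      exact WordSeries.const_of_ne _ hw
    · omega
    · rw [map_zero, WordSeries.zero_apply]

/-- The induction runs over all words at once, since the Leibniz rule for a product involves
prefixes and suffixes of `w`. -/
theorem flowHom_onPsi_mem {X : Psi K} (hX : X ∈ algR K) (w : List ℕ+) :
    (flowHom K).onPsi w X ∈ algR K := by
  have monomial_mem (w : List ℕ+) (i : ℤ) (hi : PsiDO.monomial i 1 ∈ algR K) :
      (flowHom K).onPsi w (PsiDO.monomial i 1) ∈ algR K := by
    rcases eq_or_ne w [] with rfl | hw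
    · rwa [DerivHom.onPsi_nil]
    · rw [DerivHom.onPsi_monomial_one _ hw]
      exact zero_mem _
  suffices h : ∀ (X : algR K) (w : List ℕ+), (flowHom K).onPsi w X ∈ algR K from h ⟨X, hX⟩ w
  intro X
  induction X using algR_induction with
  | one => exact fun w => monomial_mem w 0 (one_mem (algR K))
  | lax =>
    intro w
    change (flowHom K).onPsi w (laxOp K) ∈ algR K
    rw [flowHom_onPsi_laxOp]
    exact Subtype.prop _
  | delInv => exact fun w => monomial_mem w (-1) (delInv_mem K)
  | add X Y hX hY =>
    intro w
    change (flowHom K).onPsi w (X.1 + Y.1) ∈ algR K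
    rw [map_add]
    exact add_mem (hX w) (hY w)
  | smul c X hX =>
    intro w
    change (flowHom K).onPsi w (c • X.1) ∈ algR K
    rw [map_smul]
    exact (algR K).smul_mem (hX w) c
  | mul X Y hX hY =>
    intro w
    change (flowHom K).onPsi w (X.1 * Y.1) ∈ algR K
    rw [DerivHom.onPsi_mul]
    exact sum_mem fun j _ => mul_mem (hX _) (hY _)
  | pos X hX =>
    intro w
    change (flowHom K).onPsi w (PsiDO.pos X.1) ∈ algR K
    rw [DerivHom.onPsi_pos]
    exact pos_mem K (hX w)

/-- The generalized derivations of `R`. -/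
noncomputable def genDer (w : List ℕ+) : Module.End K (algR K) :=
  ((flowHom K).onPsi w).restrict (p := (algR K).toSubmodule) (q := (algR K).toSubmodule)
    fun _ hX => flowHom_onPsi_mem K hX w

theorem coe_genDer (w : List ℕ+) (X : algR K) :
    (genDer K w X : Psi K) = (flowHom K).onPsi w X := rfl

theorem genDer_L (w : List ℕ+) : genDer K w (L K) = laxFlow K w :=
  Subtype.ext (flowHom_onPsi_laxOp K w)

theorem isGenDer_genDer : IsGenDer K (genDer K) where
  nil := LinearMap.ext fun X => Subtype.ext (DerivHom.onPsi_nil _ _)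
  lax w hw := by simpa only [genDer_L] using laxFlow_of_ne K hw
  proj w X := Subtype.ext (DerivHom.onPsi_pos _ _ _)
  mul w X Y := by
    apply Subtype.ext
    rw [coe_genDer, MulMemClass.coe_mul, DerivHom.onPsi_mul, AddSubmonoidClass.coe_finsetSum]
    rfl

/-! ### The flows -/

variable {K} {δ : List ℕ+ → Module.End K (algR K)}

namespace IsGenDer

theorem lax_pos (h : IsGenDer K δ) {w : List ℕ+} (hw : w ≠ []) :
    δ w (L K) = ⁅posR K (Lw K w), L K⁆ -
      ∑ j ∈ Finset.Ico 1 w.length, δ (w.take j) (L K) * posR K (Lw K (w.drop j)) :=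
  lax_eq_pos (T := h.toHom (L K)) (h.apply_nil _) h.toHom_L_mul hw

theorem mul_singleton (h : IsGenDer K δ) (n : ℕ+) (X Y : algR K) :
    δ [n] (X * Y) = δ [n] X * Y + X * δ [n] Y := by
  rw [h.mul]
  simp [Finset.sum_range_succ, h.apply_nil, add_comm]

theorem mul_pair (h : IsGenDer K δ) (m n : ℕ+) (X Y : algR K) :
    δ [m, n] (X * Y) = δ [m, n] X * Y + X * δ [m, n] Y + δ [m] X * δ [n] Y := by
  rw [h.mul]
  simp only [List.length_cons, List.length_nil, Finset.sum_range_succ, Finset.sum_range_zero,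
    List.take_zero, List.drop_zero, List.take_succ_cons, List.drop_succ_cons, h.apply_nil,
    zero_add]
  abel

theorem lax_pair (h : IsGenDer K δ) (m n : ℕ+) :
    δ [m, n] (L K) = ⁅posR K (Lw K [m, n]), L K⁆ - δ [m] (L K) * posR K (L K ^ (n : ℕ)) := by
  rw [h.lax_pos (by simp), ← Lw_singleton]
  simp

theorem theta_mul (h : IsGenDer K δ) (m n : ℕ+) (X Y : algR K) :
    theta K δ m n (X * Y) = theta K δ m n X * Y + X * theta K δ m n Y +
      (2⁻¹ : K) • (δ [m] X * δ [n] Y - δ [n] X * δ [m] Y) := by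
  simp only [theta, LinearMap.smul_apply, LinearMap.sub_apply, h.mul_pair, smul_mul_assoc,
    mul_smul_comm, ← smul_add, sub_mul, mul_sub]
  congr 1
  abel

theorem theta_L (h : IsGenDer K δ) (m n : ℕ+) :
    theta K δ m n (L K) = ⁅W K m n, L K⁆ +
      (2⁻¹ : K) • (δ [n] (L K) * posR K (L K ^ (m : ℕ)) -
        δ [m] (L K) * posR K (L K ^ (n : ℕ))) := by
  simp only [theta, W, LinearMap.smul_apply, LinearMap.sub_apply, h.lax_pair, Ring.lie_def,
    smul_mul_assoc, mul_smul_comm, ← smul_add, ← smul_sub, map_sub, sub_mul, mul_sub]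
  congr 1
  abel

end IsGenDer

end KP

theorem theorem6p1 (K : Type*) [Field K] [CharZero K] :
    -- the defining rules determine one and only one family of operators on `R`
    (∃! δ : List ℕ+ → Module.End K (KP.algR K), KP.IsGenDer K δ) ∧
    ∀ δ : List ℕ+ → Module.End K (KP.algR K), KP.IsGenDer K δ →
      -- all generalized derivations commute
      (∀ v w : List ℕ+, ⁅δ v, δ w⁆ = 0) ∧
      -- ncKP: the `δ_n` are derivations, give the Lax flows, and the flows are compatible
      ((∀ (n : ℕ+) (X Y : KP.algR K), δ [n] (X * Y) = δ [n] X * Y + X * δ [n] Y) ∧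
        (∀ n : ℕ+, δ [n] (KP.L K) = ⁅KP.posR K (KP.L K ^ (n : ℕ)), KP.L K⁆ ∧
          δ [n] (KP.L K) = -⁅KP.negR K (KP.L K ^ (n : ℕ)), KP.L K⁆) ∧
        (∀ m n : ℕ+, δ [m] (δ [n] (KP.L K)) = δ [n] (δ [m] (KP.L K)))) ∧
      -- xncKP: Moyal rule, flows and compatibility for the `ϑ_{mn}`, also with the `δ_n`
      ((∀ (m n : ℕ+) (X Y : KP.algR K),
          KP.theta K δ m n (X * Y) = KP.theta K δ m n X * Y + X * KP.theta K δ m n Y +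
            (2⁻¹ : K) • (δ [m] X * δ [n] Y - δ [n] X * δ [m] Y)) ∧
        (∀ m n : ℕ+, KP.theta K δ m n (KP.L K) = ⁅KP.W K m n, KP.L K⁆ +
          (2⁻¹ : K) • (δ [n] (KP.L K) * KP.posR K (KP.L K ^ (m : ℕ)) -
            δ [m] (KP.L K) * KP.posR K (KP.L K ^ (n : ℕ)))) ∧
        (∀ m n p q : ℕ+, KP.theta K δ m n (KP.theta K δ p q (KP.L K)) =
          KP.theta K δ p q (KP.theta K δ m n (KP.L K))) ∧
        (∀ m n p : ℕ+, KP.theta K δ m n (δ [p] (KP.L K)) =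
          δ [p] (KP.theta K δ m n (KP.L K)))) ∧
      -- XncKP: generalized Lax flows (in the second form) and their compatibility
      ((∀ w : List ℕ+, w ≠ [] → δ w (KP.L K) = ⁅KP.posR K (KP.Lw K w), KP.L K⁆ -
          ∑ j ∈ Finset.Ico 1 w.length,
            δ (w.take j) (KP.L K) * KP.posR K (KP.Lw K (w.drop j))) ∧
        (∀ v w : List ℕ+, δ v (δ w (KP.L K)) = δ w (δ v (KP.L K)))) := by
  refine ⟨⟨KP.genDer K, KP.isGenDer_genDer K, fun δ h => h.unique (KP.isGenDer_genDer K)⟩,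
    fun δ h => ⟨fun v w => ?_, ⟨h.mul_singleton, fun n => ⟨?_, ?_⟩, fun m n => h.comm _ _ _⟩,
      ⟨h.theta_mul, h.theta_L, fun m n p q => ?_, fun m n p => ?_⟩,
      fun w hw => h.lax_pos hw, fun v w => h.comm _ _ _⟩⟩
  · rw [Ring.lie_def, sub_eq_zero]
    exact LinearMap.ext fun X => h.comm v w X
  · rw [h.lax_pos (List.cons_ne_nil n []), KP.Lw_singleton]
    simp
  · rw [h.lax [n] (List.cons_ne_nil n []), KP.Lw_singleton]
    simp
  · simp only [KP.theta, LinearMap.smul_apply, LinearMap.sub_apply, map_smul, map_sub,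
      h.comm [p, q] [m, n], h.comm [p, q] [n, m], h.comm [q, p] [m, n], h.comm [q, p] [n, m]]
    simp only [smul_sub]
    abel
  · simp only [KP.theta, LinearMap.smul_apply, LinearMap.sub_apply, map_smul, map_sub,
      h.comm [p] [m, n], h.comm [p] [n, m]]
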